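/- Let $k\ge 0$, $n\ge 1$, $b\ge 0$ be integers and let $\Gamma$ be a subgroup of the symmetric group $S_k$. Let $\Gamma^n\rtimes S_n$ be the wreath product, acting on $kn$ points that are divided into $n$ blocks of size $k$: $(\gamma_1,\dots,\gamma_n;h)$ permutes the $i$-th block by $\gamma_i\in\Gamma$ for every $i$ and then permutes the blocks by $h\in S_n$. For a permutation $\sigma$ let $a_i(\sigma)$ be its number of $i$-cycles (fixed points are 1-cycles); for a partition $\lambda\vdash k$ let $a_j(\lambda)$ be the number of parts of $\lambda$ equal to $j$, and let $P_\Gamma(\lambda)$ be the probability that a uniform element of $\Gamma$ has cycle type $\lambda$. Write $\|\mu-\nu\|_{TV}=\sup_A|\mu(A)-\nu(A)|$. **(1)** Let $Z_{l,\lambda}$ ($l\ge 1$, $\lambda\vdash k$) be independent with $Z_{l,\lambda}\sim\mathrm{Poisson}(P_\Gamma(\lambda)/l)$, and put $$A_i=\sum_{jl=i}\ \sum_{\lambda\vdash k}a_j(\lambda)\,Z_{l,\lambda}\qquad(i\ge 1).$$ Let $\mu$ be the law of $(a_1(\sigma),\dots,a_b(\sigma))$ for $\sigma$ uniform in $\Gamma^n\rtimes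 S_n$, and $\nu$ the law of $(A_1,\dots,A_b)$. Then $$\|\mu-\nu\|_{TV}\le \frac{2b}{n}.$$ **(2)** Let $\zeta_1,\zeta_2,\dots$ be independent Bernoulli variables with $P(\zeta_i=1)=1/i$ and, independently of them, let $Y_1,Y_2,\dots$ be i.i.d. partitions of $k$ with $P(Y_i=\lambda)=P_\Gamma(\lambda)$. A binary sequence $x_1,x_2,\dots$ has an $l$-spacing starting at position $i$ if $x_i x_{i+1}\cdots x_{i+l}=1\,0^{l-1}\,1$. Let $E_{l,i}$ and $E^\infty_{l,i}$ be the events that there is an $l$-spacing starting at position $i$ in the sequence $\zeta_1,\dots,\zeta_n,1,0,0,\dots$ and in the infinite sequence $\zeta_1,\zeta_2,\dots$, respectively, and for $c\ge1$ put $$C_c=\sum_{jl=c}\sum_{i=1}^n a_j(Y_i)1_{E_{l,i}},\qquad C_c^\infty=\sum_{jl=c}\sum_{i=1}^\infty a_j(Y_i)1_{E^\infty_{l,i}}.$$ Then the laws $\mu'$ of $(C_1,\dots,C_b)$ and $\nu'$ of $(C^\infty_1,\dots,C^\infty_b)$ satisfy $$\|\mu'-\nu'\|_{TV}\le\frac{2b}{n},$$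 and moreover $$P\{C_c\ne C_c^\infty\text{ for some }1\le c\le b\}\le\frac{2b}{n+1}.$$ -/

import Mathlib

open MeasureTheory ProbabilityTheory
open scoped NNReal ENNReal

noncomputable section

/-- Total variation distance `sup_A |μ(A) - ν(A)|`, the supremum over all measurable sets `A`
(used for probability measures only, where this is a supremum of numbers in `[0, 1]`). -/
def tvDist {α : Type*} [MeasurableSpace α] (μ ν : Measure α) : ℝ :=
  ⨆ A : {A : Set α // MeasurableSet A}, |μ.real A.1 - ν.real A.1|

/-- `cycleCount σ i` is `a_i(σ)`, the number of `i`-cycles of `σ` (fixed points are `1`-cycles). -/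
def cycleCount {α : Type*} [Fintype α] [DecidableEq α] (σ : Equiv.Perm α) (i : ℕ) : ℕ :=
  σ.partition.parts.count i

/-- The wreath product `Γ^n ⋊ S_n` of `Γ ⊆ S_k`, as a group of permutations of `kn` points.
The point `(i, x)` is the `x`-th element of the `i`-th of the `n` blocks of size `k`; the
element `(γ_1, …, γ_n; h)` first applies `γ_i` inside block `i`, for every `i`, and then moves
the blocks by `h`. -/
def wreath {k : ℕ} (Γ : Subgroup (Equiv.Perm (Fin k))) (n : ℕ) :
    Subgroup (Equiv.Perm (Fin n × Fin k)) where
  carrier := {σ | ∃ (γ : Fin n → Equiv.Perm (Fin k)) (h : Equiv.Perm (Fin n)),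
    (∀ i, γ i ∈ Γ) ∧ ∀ i x, σ (i, x) = (h i, γ i x)}
  one_mem' := ⟨fun _ => 1, 1, fun _ => Γ.one_mem, fun _ _ => rfl⟩
  mul_mem' := by
    rintro σ τ ⟨γ, h, hγ, hσ⟩ ⟨δ, g, hδ, hτ⟩
    refine ⟨fun i => γ (g i) * δ i, h * g, fun i => Γ.mul_mem (hγ _) (hδ _), fun i x => ?_⟩
    simp [Equiv.Perm.mul_apply, hσ, hτ]
  inv_mem' := by
    rintro σ ⟨γ, h, hγ, hσ⟩
    refine ⟨fun i => (γ (h⁻¹ i))⁻¹, h⁻¹, fun i => Γ.inv_mem (hγ _), fun i x => ?_⟩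
    rw [Equiv.Perm.inv_eq_iff_eq, hσ]
    simp

/-- The law of `(a_1(σ), …, a_b(σ))` for `σ` uniformly distributed on `Γ^n ⋊ S_n`. -/
def wreathCycleLaw {k : ℕ} (Γ : Subgroup (Equiv.Perm (Fin k))) (n b : ℕ) :
    Measure (Finset.Icc 1 b → ℕ) :=
  letI : Fintype (wreath Γ n) := Fintype.ofFinite _
  ((PMF.uniformOfFintype (wreath Γ n)).map
    fun σ (i : Finset.Icc 1 b) => cycleCount σ.1 i.1).toMeasure

/-- `P_Γ(lam)`: the probability that a uniform element of `Γ ⊆ S_k` has cycle type `lam ⊢ k`. -/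
def cycleTypeProb {k : ℕ} (Γ : Subgroup (Equiv.Perm (Fin k))) (lam : k.Partition) : ℝ≥0 :=
  (Nat.card {γ : Γ // γ.1.partition.parts = lam.parts} : ℝ≥0) / (Nat.card Γ : ℝ≥0)

/-- Partitions of `k` form a discrete measurable space. -/
instance instMeasurableSpaceNatPartition {k : ℕ} : MeasurableSpace k.Partition := ⊤

/-- Independent `Z_{l,lam} ∼ Poisson(P_Γ(lam) / l)`, for `l ≥ 1` and `lam ⊢ k`.
(The variables `Z 0 lam` are not constrained and never used.) -/
structure IsPoissonFamily {k : ℕ} (Γ : Subgroup (Equiv.Perm (Fin k))) {Ω : Type*}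
    [MeasurableSpace Ω] (P : Measure Ω) (Z : ℕ → k.Partition → Ω → ℕ) : Prop where
  measurable : ∀ (l : ℕ+) (lam : k.Partition), Measurable (Z l lam)
  law : ∀ (l : ℕ+) (lam : k.Partition),
    P.map (Z l lam) = poissonMeasure (cycleTypeProb Γ lam / (l : ℝ≥0))
  indep : iIndepFun (fun p : ℕ+ × k.Partition => Z p.1 p.2) P

/-- `A_i = ∑_{jl = i} ∑_{lam ⊢ k} a_j(lam) Z_{l,lam}`. -/
def compoundPoisson {k : ℕ} {Ω : Type*} (Z : ℕ → k.Partition → Ω → ℕ) (i : ℕ) (ω : Ω) : ℕ :=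
  ∑ p ∈ i.divisorsAntidiagonal, ∑ lam : k.Partition, lam.parts.count p.1 * Z p.2 lam ω

/-- The binary sequence `x_1, x_2, …` has an `l`-spacing starting at position `i`:
`x_i ⋯ x_{i+l} = 1 0^{l-1} 1`. -/
abbrev IsSpacing (x : ℕ → Bool) (l i : ℕ) : Prop :=
  x i = true ∧ (∀ m ∈ Finset.Ioo i (i + l), x m = false) ∧ x (i + l) = true

/-- `∑_{jl = b} ∑_{i=1}^N a_j(y_i) 1{x has an l-spacing starting at i}`. -/
def spacingCount {k : ℕ} (x : ℕ → Bool) (y : ℕ → k.Partition) (N b : ℕ) : ℕ :=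
  ∑ p ∈ b.divisorsAntidiagonal, ∑ i ∈ Finset.Icc 1 N,
    if IsSpacing x p.2 i then (y i).parts.count p.1 else 0

/-- The sequence `x_1, …, x_n, 1, 0, 0, …`. -/
def truncSeq (n : ℕ) (x : ℕ → Bool) (m : ℕ) : Bool :=
  if m ≤ n then x m else decide (m = n + 1)

/-- `C_b`, built from the `n` terms `x_1, …, x_n` followed by a terminal `1`. -/
def finiteCount {k : ℕ} (n : ℕ) (x : ℕ → Bool) (y : ℕ → k.Partition) (b : ℕ) : ℕ :=
  spacingCount (truncSeq n x) y n b

/-- `C_b^∞`, built from the infinite sequence `x_1, x_2, …`: the sum over all starting positions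
`i ≥ 1`, as the supremum of its partial sums (a sum of natural numbers, a priori in `ℕ∞`). -/
def infiniteCount {k : ℕ} (x : ℕ → Bool) (y : ℕ → k.Partition) (b : ℕ) : ℕ∞ :=
  ⨆ N : ℕ, (spacingCount x y N b : ℕ∞)

/-- Independent Bernoulli variables `ζ_i`, `i ≥ 1`, with `P(ζ_i = 1) = 1/i`, and, independently
of them, i.i.d. `Y_i`, `i ≥ 1`, distributed as the cycle type of a uniform element of `Γ`.
(`ζ 0` and `Y 0` are not constrained and never used.) -/
structure IsSpacingData {k : ℕ} (Γ : Subgroup (Equiv.Perm (Fin k))) {Ω : Type*}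
    [MeasurableSpace Ω] (P : Measure Ω) (ζ : ℕ → Ω → Bool) (Y : ℕ → Ω → k.Partition) : Prop where
  measurable_zeta : ∀ i : ℕ+, Measurable (ζ i)
  measurable_Y : ∀ i : ℕ+, Measurable (Y i)
  law_zeta : ∀ i : ℕ+, P.real {ω | ζ i ω = true} = 1 / (i : ℝ)
  law_Y : ∀ (i : ℕ+) (lam : k.Partition), P.real {ω | Y i ω = lam} = cycleTypeProb Γ lam
  indep_zeta : iIndepFun (fun i : ℕ+ => ζ i) P
  indep_Y : iIndepFun (fun i : ℕ+ => Y i) P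
  indep : IndepFun (fun ω (i : ℕ+) => ζ i ω) (fun ω (i : ℕ+) => Y i ω) P

end

/-!
The cycles of an element `(γ; h)` of the wreath product sit over the cycles of `h`. An `l`-cycle of
`h` carries a cycle product `ρ ∈ Γ`, and every `j`-cycle of `ρ` gives one `jl`-cycle of `(γ; h)`
(`minimalPeriod_prodShear`, `cycleCount_prodShear`); for uniform `γ` the cycle products are
independent and uniform (`sum_cycleProduct`). So the cycle counts are a fixed function
(`assembleCounts`) of the numbers of block cycles of each colour `(l, lam)`, `l ≤ b`, where `lam` is
the cycle type of `ρ`, just as the compound Poisson variables are the same function of the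
independent Poisson variables. It suffices to compare the coloured block cycles with the Poisson
variables.

The generating function of the coloured counts is the cycle index `U n` of `S_n` at weights `g l`,
where `g l = ∑ lam, P_Γ(lam) X (l, lam)` for `l ≤ b` and `g l = 1` for `l > b`. Formally
`∑ U n t ^ n = exp (∑ g l t ^ l / l)`, and two consequences of the resulting recursion
`succ_smul_cycleIndex_succ` are needed.

* Since `g l = 1` for `l > b`,
  `m (U m - U (m - 1)) = ∑_{l ≤ b} (g l - 1) (U (m - l) - U (m - l - 1))`. Summation by parts over
  `m > n` bounds the `ℓ¹` distance of `U M` and `U n`, for all `M ≥ n`, by `4 b / (n + 1)`, that is,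
  the total variation distance by `2 b / (n + 1)` (`Seminorm.cycleIndex_sub_le`).
* A derivation `D` satisfies `D (U n) = ∑ (D (g l) / l) U (n - l)` (`derivation_cycleIndex`). For
  the partial derivatives this shows that the coefficients `L a = lim (U n).coeff a` satisfy
  `L (a + e i) (a i + 1) = r i * L a` with `r (l, lam) = P_Γ(lam) / l`, the recursion of the product
  of Poisson weights. As no mass escapes in the limit, `L` is that product
  (`sum_coeff_cycleIndex_sub_le`).

For the Bernoulli sequences, the two families of spacings of length at most `b` agree unless the
terminal `1` closes a spacing while `ζ (n + 1) = 0`, or the infinite sequence has a spacing ending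
after `n + 1` (`isSpacing_truncSeq_iff`). For each length `l ≤ b` both events have probability at
most `1 / (n + 1)`, the second by a telescoping sum (`IsSpacingData.measure_spacingsDiffer_le`), and
the coupling inequality turns this into a bound for the laws.
-/

open Finset.HasAntidiagonal (antidiagonal)

/-! ### The cycle index of the symmetric group -/

/-- `∏ l, l ^ aₗ * aₗ!`, for a multiset in which `l` occurs `aₗ` times. -/
def symmetryFactor (m : Multiset ℕ) : ℕ :=
  m.prod * ∏ l ∈ m.toFinset, (m.count l).factorial

theorem prod_factorial_count_eq (m : Multiset ℕ) {s : Finset ℕ} (h : m.toFinset ⊆ s) :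
    ∏ l ∈ m.toFinset, (m.count l).factorial = ∏ l ∈ s, (m.count l).factorial := by
  refine Finset.prod_subset h fun l _ hl => ?_
  rw [Multiset.count_eq_zero_of_notMem (by simpa using hl), Nat.factorial_zero]

theorem symmetryFactor_cons (l : ℕ) (m : Multiset ℕ) :
    symmetryFactor (l ::ₘ m) = l * (m.count l + 1) * symmetryFactor m := by
  have hl : l ∈ (l ::ₘ m).toFinset := by simp
  have hs : m.toFinset ⊆ (l ::ₘ m).toFinset := by simp
  have h : ∏ i ∈ (l ::ₘ m).toFinset.erase l, ((l ::ₘ m).count i).factorial =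
      ∏ i ∈ (l ::ₘ m).toFinset.erase l, (m.count i).factorial :=
    Finset.prod_congr rfl fun i hi => by
      rw [Multiset.count_cons_of_ne (Finset.ne_of_mem_erase hi)]
  rw [symmetryFactor, symmetryFactor, prod_factorial_count_eq m hs,
    ← Finset.mul_prod_erase _ _ hl, ← Finset.mul_prod_erase _ _ hl, h,
    Multiset.count_cons_self, Multiset.prod_cons, Nat.factorial_succ]
  ring

theorem symmetryFactor_pos {m : Multiset ℕ} (h : ∀ i ∈ m, 0 < i) : 0 < symmetryFactor m :=
  Nat.mul_pos (Multiset.prod_pos h) (Finset.prod_pos fun _ _ => Nat.factorial_pos _)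

/-- The number of permutations with a given cycle type, fixed points being counted as parts. -/
theorem card_partition_parts_eq_mul (n : ℕ) (p : n.Partition) :
    Fintype.card {h : Equiv.Perm (Fin n) // h.partition.parts = p.parts} *
      symmetryFactor p.parts = n.factorial := by
  classical
  -- Mathlib counts permutations by `cycleType`, which omits the fixed points: split off the `1`s
  have hsplit : p.parts = p.parts.filter (2 ≤ ·) + Multiset.replicate (p.parts.count 1) 1 := by
    conv_lhs => rw [← Multiset.filter_add_not (2 ≤ ·) p.parts]
    congr 1
    rw [← Multiset.filter_eq']
    refine Multiset.filter_congr fun x hx => ?_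
    have := p.parts_pos hx
    omega
  set c := p.parts.filter (2 ≤ ·) with hc
  have hsum : c.sum + p.parts.count 1 = n := by
    have := congrArg Multiset.sum hsplit
    rw [p.parts_sum, Multiset.sum_add, Multiset.sum_replicate] at this
    simpa using this.symm
  have hc2 : ∀ a ∈ c, 2 ≤ a := fun a ha => (Multiset.mem_filter.1 ha).2
  have h1c : (1 : ℕ) ∉ c := fun h => by have := hc2 1 h; omega
  have key := Equiv.Perm.card_of_cycleType_mul_eq (Fin n) c
  rw [if_pos ⟨by simp; omega, hc2⟩, Fintype.card_fin] at key
  rw [← key, Fintype.card_subtype, mul_assoc]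
  congr 1
  · congr 1
    ext h
    simp only [Finset.mem_filter, Finset.mem_univ, true_and]
    constructor
    · intro hh
      rw [← Equiv.Perm.filter_parts_partition_eq_cycleType, hh]
    · intro hh
      rw [Equiv.Perm.parts_partition, ← Equiv.Perm.sum_cycleType, hh, hsplit]
      congr 2
      simp
      omega
  · rw [symmetryFactor, show n - c.sum = p.parts.count 1 by omega]
    have hprod : p.parts.prod = c.prod := by
      conv_lhs => rw [hsplit]
      simp
    rw [prod_factorial_count_eq p.parts (Finset.subset_insert 1 _),
      prod_factorial_count_eq c (s := insert 1 p.parts.toFinset),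
      ← Finset.mul_prod_erase _ _ (Finset.mem_insert_self 1 _),
      ← Finset.mul_prod_erase _ (fun l => (c.count l).factorial) (Finset.mem_insert_self 1 _),
      Multiset.count_eq_zero_of_notMem h1c, hprod]
    · have : ∏ i ∈ (insert 1 p.parts.toFinset).erase 1, (p.parts.count i).factorial =
          ∏ i ∈ (insert 1 p.parts.toFinset).erase 1, (c.count i).factorial := by
        refine Finset.prod_congr rfl fun i hi => ?_
        have h1 := Finset.ne_of_mem_erase hi
        conv_lhs => rw [hsplit]
        rw [Multiset.count_add, Multiset.count_replicate, if_neg (Ne.symm h1), add_zero]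
      rw [this]
      simp; ring
    · exact (Multiset.toFinset_subset.2 (Multiset.filter_subset _ _)).trans
        (Finset.subset_insert _ _)

/-- The cycle type of a permutation of `Fin n`, as a partition of `n`. -/
def permPartition {n : ℕ} (h : Equiv.Perm (Fin n)) : n.Partition :=
  ⟨h.partition.parts, h.partition.parts_pos, by rw [h.partition.parts_sum, Fintype.card_fin]⟩

section CycleIndex

variable {R : Type*} [CommRing R] [Algebra ℝ R]

/-- The cycle index of the symmetric group `S_n`, evaluated at weights `g l` for the `l`-cycles:
the average over `S_n` of the product of `g` over the cycle lengths. It is written here as a sum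
over partitions; `sum_prod_partition_eq` is the expression as a sum over permutations. -/
noncomputable def cycleIndex (g : ℕ → R) (n : ℕ) : R :=
  ∑ p : n.Partition, (symmetryFactor p.parts : ℝ)⁻¹ • (p.parts.map g).prod

theorem sum_prod_partition_eq (g : ℕ → R) (n : ℕ) :
    ∑ h : Equiv.Perm (Fin n), (h.partition.parts.map g).prod =
      (n.factorial : ℝ) • cycleIndex g n := by
  classical
  rw [cycleIndex, Finset.smul_sum, ← Finset.sum_fiberwise (g := permPartition)]
  refine Finset.sum_congr rfl fun p _ => ?_
  have hz : (symmetryFactor p.parts : ℝ) ≠ 0 :=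
    Nat.cast_ne_zero.2 (symmetryFactor_pos fun i hi => p.parts_pos hi).ne'
  rw [Finset.sum_congr rfl (g := fun _ => (p.parts.map g).prod)]
  · rw [Finset.sum_const, ← card_partition_parts_eq_mul n p, Fintype.card_subtype, smul_smul,
      ← Nat.cast_smul_eq_nsmul ℝ, Nat.cast_mul, mul_assoc, mul_inv_cancel₀ hz, mul_one]
    congr 3
    ext h
    simp [permPartition, Nat.Partition.ext_iff]
  · intro h hh
    rw [← (Finset.mem_filter.1 hh).2]
    rfl

@[simp]
theorem cycleIndex_zero (g : ℕ → R) : cycleIndex g 0 = 1 := by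
  simp [cycleIndex, symmetryFactor]

/-- The recursion obtained by removing the cycle through a fixed point. -/
theorem succ_smul_cycleIndex_succ (g : ℕ → R) (n : ℕ) :
    ((n : ℝ) + 1) • cycleIndex g (n + 1) =
      ∑ q ∈ antidiagonal n, g (q.1 + 1) * cycleIndex g q.2 := by
  classical
  -- every partition of `n + 1` is weighted by `∑ l, l * aₗ = n + 1`; then one part `l` is removed
  have hcount : ∀ p : (n + 1).Partition,
      ∑ q ∈ antidiagonal n, ((q.1 + 1) * p.parts.count (q.1 + 1) : ℕ) = n + 1 := by
    intro p
    rw [Finset.Nat.sum_antidiagonal_eq_sum_range_succ_mk]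
    conv_rhs => rw [← p.parts_sum, Finset.sum_multiset_count_of_subset p.parts
      (Finset.range (n + 2)) (by
        intro i hi
        have := p.le_of_mem_parts (Multiset.mem_toFinset.1 hi)
        simp; omega)]
    rw [Finset.sum_range_succ' _ (n + 1)]
    simp [mul_comm]
  have h1 : ((n : ℝ) + 1) • cycleIndex g (n + 1) =
      ∑ q ∈ antidiagonal n, ∑ p : (n + 1).Partition,
        (((q.1 + 1) * p.parts.count (q.1 + 1) : ℕ) * (symmetryFactor p.parts : ℝ)⁻¹) •
          (p.parts.map g).prod := by
    rw [Finset.sum_comm, cycleIndex, Finset.smul_sum]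
    refine Finset.sum_congr rfl fun p _ => ?_
    rw [← Finset.sum_smul, ← Finset.sum_mul, ← Nat.cast_sum, hcount, smul_smul]
    push_cast
    rfl
  rw [h1]
  refine Finset.sum_congr rfl fun q hq => ?_
  have hqn : q.1 + q.2 = n := Finset.HasAntidiagonal.mem_antidiagonal.1 hq
  obtain ⟨a, m⟩ := q
  obtain rfl : m = n + 1 - (a + 1) := by simp at hqn; omega
  rw [cycleIndex, Finset.mul_sum]
  rw [← Finset.sum_subset (Finset.filter_subset (fun p : (n+1).Partition => a + 1 ∈ p.parts) _)]
  · rw [← Finset.sum_subtype_eq_sum_filter]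
    rw [Finset.subtype_univ]
    refine Fintype.sum_equiv (Nat.Partition.partitionWithPartEquiv (by omega) (by omega)) _ _ ?_
    rintro ⟨p, hp⟩
    rw [Nat.Partition.partitionWithPartEquiv_apply_parts]
    have hz : (symmetryFactor (p.parts.erase (a + 1)) : ℝ) ≠ 0 :=
      Nat.cast_ne_zero.2 (symmetryFactor_pos fun i hi =>
        p.parts_pos (Multiset.mem_of_mem_erase hi)).ne'
    obtain ⟨t, ht⟩ := Multiset.exists_cons_of_mem hp
    simp only [ht, Multiset.erase_cons_head] at hz ⊢
    rw [symmetryFactor_cons, Multiset.map_cons, Multiset.prod_cons, Multiset.count_cons_self,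
      ← mul_smul_comm]
    push_cast
    rw [mul_smul_comm, ← mul_smul_comm]
    congr 2
    field_simp
  · intro p _ hp
    rw [Multiset.count_eq_zero_of_notMem (by simpa using hp)]
    simp

theorem map_cycleIndex {S : Type*} [CommRing S] [Algebra ℝ S] (f : R →ₐ[ℝ] S) (g : ℕ → R)
    (n : ℕ) : f (cycleIndex g n) = cycleIndex (fun l => f (g l)) n := by
  simp [cycleIndex, map_multiset_prod, Multiset.map_map]

end CycleIndex

/-! ### Size biasing, and the rate of convergence of the cycle indices -/

section Derivation

variable {R : Type*} [CommRing R] [Algebra ℝ R]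

/-- A power series `F` with `F' = G F` and `F(0) = 0` vanishes. -/
theorem powerSeries_eq_zero_of_derivative_eq_mul (F G : PowerSeries R)
    (h : PowerSeries.derivative R F = G * F) (h0 : PowerSeries.coeff 0 F = 0) : F = 0 := by
  ext n
  rw [map_zero]
  induction n using Nat.strong_induction_on with
  | _ n ih =>
    rcases n with _ | n
    · exact h0
    · have h1 := congrArg (PowerSeries.coeff n) h
      rw [PowerSeries.coeff_derivative, PowerSeries.coeff_mul, Finset.sum_eq_zero] at h1
      · have h2 : ((n : ℝ) + 1) • PowerSeries.coeff (n + 1) F = 0 := by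
          rw [Algebra.smul_def, mul_comm]
          simpa using h1
        have h3 : (n : ℝ) + 1 ≠ 0 := by positivity
        rw [← one_smul ℝ (PowerSeries.coeff (n + 1) F), ← inv_mul_cancel₀ h3, mul_smul, h2,
          smul_zero]
      · intro q hq
        rw [ih q.2 (by have := Finset.HasAntidiagonal.mem_antidiagonal.1 hq; omega), mul_zero]

/-- The size-biasing identity: on the level of generating functions, the cycle indices are the
coefficients of `exp (∑ g l t ^ l / l)`, so a derivation `D` multiplies them by
`∑ D (g l) t ^ l / l`. At `l = 0` the coefficient is `0⁻¹ = 0`. -/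
theorem derivation_cycleIndex (D : Derivation ℝ R R) (g : ℕ → R) (n : ℕ) :
    D (cycleIndex g n) =
      ∑ q ∈ antidiagonal n, ((q.1 : ℝ)⁻¹ • D (g q.1)) * cycleIndex g q.2 := by
  set Dm : PowerSeries R → PowerSeries R :=
    fun f => PowerSeries.mk fun n => D (PowerSeries.coeff n f) with hDm
  set U : PowerSeries R := PowerSeries.mk (cycleIndex g) with hU
  set G : PowerSeries R := PowerSeries.mk fun n => g (n + 1) with hG
  set W : PowerSeries R := PowerSeries.mk fun l => (l : ℝ)⁻¹ • D (g l) with hW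
  have hmul : ∀ f h, Dm (f * h) = Dm f * h + f * Dm h := by
    intro f h
    ext m
    simp only [hDm, PowerSeries.coeff_mk, PowerSeries.coeff_mul, map_add, map_sum,
      Derivation.leibniz, smul_eq_mul]
    rw [← Finset.sum_add_distrib]
    exact Finset.sum_congr rfl fun _ _ => by ring
  have hder : ∀ f, PowerSeries.derivative R (Dm f) = Dm (PowerSeries.derivative R f) := by
    intro f
    ext m
    have : D ((m : R) + 1) = 0 := by simp
    simp only [hDm, PowerSeries.coeff_mk, PowerSeries.coeff_derivative, Derivation.leibniz, this,
      smul_eq_mul, mul_zero, zero_add]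
    ring
  have hU' : PowerSeries.derivative R U = G * U := by
    ext m
    rw [PowerSeries.coeff_derivative, PowerSeries.coeff_mul]
    simp only [hU, hG, PowerSeries.coeff_mk]
    rw [← succ_smul_cycleIndex_succ, Algebra.smul_def, mul_comm]
    simp
  have hW' : PowerSeries.derivative R W = Dm G := by
    ext m
    rw [PowerSeries.coeff_derivative]
    simp only [hW, hG, hDm, PowerSeries.coeff_mk]
    have h3 : (m : ℝ) + 1 ≠ 0 := by positivity
    have : ((m : R) + 1) = algebraMap ℝ R ((m : ℝ) + 1) := by simp
    rw [this, mul_comm, ← Algebra.smul_def, smul_smul]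
    push_cast
    rw [mul_inv_cancel₀ h3, one_smul]
  -- both `Dm U` and `W * U` solve `F' = G F + (Dm G) U`
  have hK : Dm U - W * U = 0 := by
    refine powerSeries_eq_zero_of_derivative_eq_mul _ G ?_ ?_
    · rw [map_sub, hder, hU', hmul, Derivation.leibniz, hU', hW', smul_eq_mul, smul_eq_mul]
      ring
    · simp [hDm, hU, hW]
  have := congrArg (PowerSeries.coeff n) (sub_eq_zero.1 hK)
  simpa only [hDm, hU, hW, PowerSeries.coeff_mk, PowerSeries.coeff_mul] using this

end Derivation

section Comparison

variable {R : Type*} [CommRing R] [Algebra ℝ R] (N : Seminorm ℝ R)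

theorem Seminorm.cycleIndex_le_one (hmul : ∀ x y, N (x * y) ≤ N x * N y) (hone : N 1 ≤ 1)
    {g : ℕ → R} (hg : ∀ l, N (g l) ≤ 1) (n : ℕ) : N (cycleIndex g n) ≤ 1 := by
  induction n using Nat.strong_induction_on with
  | _ n ih =>
    rcases n with _ | n
    · simpa using hone
    · have h3 : (0 : ℝ) < (n : ℝ) + 1 := by positivity
      have h1 := congrArg N (succ_smul_cycleIndex_succ g n)
      rw [map_smul_eq_mul, Real.norm_of_nonneg h3.le] at h1
      have h2 : N (∑ q ∈ antidiagonal n, g (q.1 + 1) * cycleIndex g q.2) ≤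
          ∑ q ∈ antidiagonal n, (1 : ℝ) := by
        refine (Finset.le_sum_of_subadditive N (map_zero N).le (map_add_le_add N) _ _).trans
          (Finset.sum_le_sum fun q hq => ?_)
        refine (hmul _ _).trans (mul_le_one₀ (hg _) (apply_nonneg N _) (ih _ ?_))
        have := Finset.HasAntidiagonal.mem_antidiagonal.1 hq
        omega
      rw [← h1] at h2
      simp only [Finset.sum_const, Finset.Nat.card_antidiagonal, nsmul_eq_mul, mul_one] at h2
      push_cast at h2
      nlinarith

/-- Summation by parts: the increments of a sequence in the unit ball, the `m`-th one weighted by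
`1 / m`, have tails that decay like `2 / m`. -/
theorem Seminorm.sum_inv_smul_sub_le (y : ℕ → R) (hy : ∀ m, N (y m) ≤ 1) {n M : ℕ} (h : n ≤ M) :
    N (∑ m ∈ Finset.Ico n M, ((m : ℝ) + 1)⁻¹ • (y (m + 1) - y m)) ≤ 2 * ((n : ℝ) + 1)⁻¹ := by
  have key : N (∑ m ∈ Finset.Ico n M, ((m : ℝ) + 1)⁻¹ • (y (m + 1) - y m) -
      ((M : ℝ) + 1)⁻¹ • y M) ≤ 2 * ((n : ℝ) + 1)⁻¹ - ((M : ℝ) + 1)⁻¹ := by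
    induction M, h using Nat.le_induction with
    | base =>
      have h3 : (0 : ℝ) < ((n : ℝ) + 1)⁻¹ := by positivity
      rw [Finset.Ico_self, Finset.sum_empty, zero_sub, map_neg_eq_map, map_smul_eq_mul,
        Real.norm_of_nonneg h3.le]
      nlinarith [hy n]
    | succ M hM ih =>
      have h4 : ((M : ℝ) + 1 + 1)⁻¹ ≤ ((M : ℝ) + 1)⁻¹ := by
        gcongr; linarith
      rw [Finset.sum_Ico_succ_top hM]
      push_cast
      have e : ∀ S : R, S + ((M : ℝ) + 1)⁻¹ • (y (M + 1) - y M) - ((M : ℝ) + 1 + 1)⁻¹ • y (M + 1)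
          = (S - ((M : ℝ) + 1)⁻¹ • y M) +
            (((M : ℝ) + 1)⁻¹ - ((M : ℝ) + 1 + 1)⁻¹) • y (M + 1) := by
        intro S
        module
      rw [e]
      refine (map_add_le_add N _ _).trans ?_
      rw [map_smul_eq_mul, Real.norm_of_nonneg (sub_nonneg.2 h4)]
      nlinarith [hy (M + 1)]
  have h3 : (0 : ℝ) < ((M : ℝ) + 1)⁻¹ := by positivity
  have := map_add_le_add N (∑ m ∈ Finset.Ico n M, ((m : ℝ) + 1)⁻¹ • (y (m + 1) - y m) -
      ((M : ℝ) + 1)⁻¹ • y M) (((M : ℝ) + 1)⁻¹ • y M)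
  rw [sub_add_cancel, map_smul_eq_mul, Real.norm_of_nonneg h3.le] at this
  nlinarith [hy M]

/-- When only the cycles of length at most `b` carry a weight, consecutive cycle indices differ
by `1 / (m + 1)` times increments of earlier cycle indices. -/
theorem succ_smul_cycleIndex_sub {g : ℕ → R} {b : ℕ} (hb : ∀ l, b < l → g l = 1) (m : ℕ) :
    ((m : ℝ) + 1) • (cycleIndex g (m + 1) - cycleIndex g m) =
      ∑ l ∈ Finset.range b, (g (l + 1) - 1) *
        ((if l + 1 ≤ m + 1 then cycleIndex g (m + 1 - (l + 1)) else 0) -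
          (if l + 1 ≤ m then cycleIndex g (m - (l + 1)) else 0)) := by
  have key : ∀ m : ℕ, (m : ℝ) • cycleIndex g m =
      ∑ l ∈ Finset.range b, (g (l + 1) - 1) *
        (if l + 1 ≤ m then cycleIndex g (m - (l + 1)) else 0) +
      ∑ j ∈ Finset.range m, cycleIndex g j := by
    intro m
    rcases m with _ | m
    · simp
    rw [Nat.cast_succ, succ_smul_cycleIndex_succ, Finset.Nat.sum_antidiagonal_eq_sum_range_succ_mk]
    have h1 : ∑ l ∈ Finset.range b, (g (l + 1) - 1) *
        (if l + 1 ≤ m + 1 then cycleIndex g (m + 1 - (l + 1)) else 0) =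
        ∑ l ∈ Finset.range (m + 1), (g (l + 1) - 1) * cycleIndex g (m - l) := by
      have hA : Finset.range (m + 1) ⊆ Finset.range (max b (m + 1)) := by simp
      have hB : Finset.range b ⊆ Finset.range (max b (m + 1)) := by simp
      rw [Finset.sum_subset hB, ← Finset.sum_subset hA]
      · refine Finset.sum_congr rfl fun l hl => ?_
        rw [if_pos (by simp at hl; omega), Nat.add_sub_add_right]
      · intro l _ hl
        rw [if_neg (by simp at hl; omega), mul_zero]
      · intro l _ hl
        rw [hb (l + 1) (by simp at hl; omega)]
        simp
    rw [h1, ← Finset.sum_range_reflect (fun j => cycleIndex g j), ← Finset.sum_add_distrib]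
    refine Finset.sum_congr rfl fun l _ => ?_
    simp only [Nat.add_sub_cancel]
    ring
  have h1 := key (m + 1)
  have h2 := key m
  rw [Finset.sum_range_succ] at h1
  have e : ((m : ℝ) + 1) • (cycleIndex g (m + 1) - cycleIndex g m) =
      ((m + 1 : ℕ) : ℝ) • cycleIndex g (m + 1) - (m : ℝ) • cycleIndex g m - cycleIndex g m := by
    push_cast
    module
  rw [e, h1, h2]
  simp only [mul_sub, Finset.sum_sub_distrib]
  ring

/-- The cycle indices form a Cauchy sequence for a submultiplicative seminorm, with an explicit
rate: each of the `b` lengths contributes a factor `g l - 1` of seminorm at most `2` times a sum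
handled by `Seminorm.sum_inv_smul_sub_le`. -/
theorem Seminorm.cycleIndex_sub_le (hmul : ∀ x y, N (x * y) ≤ N x * N y) (hone : N 1 ≤ 1)
    {g : ℕ → R} (hg : ∀ l, N (g l) ≤ 1) {b : ℕ} (hb : ∀ l, b < l → g l = 1) {n M : ℕ}
    (h : n ≤ M) : N (cycleIndex g M - cycleIndex g n) ≤ 4 * b / ((n : ℝ) + 1) := by
  -- `x l` is the sequence of cycle indices delayed by `l`
  set x : ℕ → ℕ → R := fun l m => if l ≤ m then cycleIndex g (m - l) else 0 with hx
  have hx1 : ∀ l m, N (x l m) ≤ 1 := by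
    intro l m
    simp only [hx]
    split_ifs
    · exact N.cycleIndex_le_one hmul hone hg _
    · simp
  have e : cycleIndex g M - cycleIndex g n = ∑ l ∈ Finset.range b, (g (l + 1) - 1) *
      ∑ m ∈ Finset.Ico n M, ((m : ℝ) + 1)⁻¹ • (x (l + 1) (m + 1) - x (l + 1) m) := by
    rw [← Finset.sum_Ico_sub _ h]
    simp only [Finset.mul_sum]
    rw [Finset.sum_comm]
    refine Finset.sum_congr rfl fun m _ => ?_
    have h3 : (m : ℝ) + 1 ≠ 0 := by positivity
    simp only [mul_smul_comm]
    rw [← Finset.smul_sum, ← succ_smul_cycleIndex_sub hb, smul_smul, inv_mul_cancel₀ h3, one_smul]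
  rw [e]
  refine (Finset.le_sum_of_subadditive N (map_zero N).le (map_add_le_add N) _ _).trans ?_
  have : ∀ l ∈ Finset.range b, N ((g (l + 1) - 1) *
      ∑ m ∈ Finset.Ico n M, ((m : ℝ) + 1)⁻¹ • (x (l + 1) (m + 1) - x (l + 1) m)) ≤
      2 * (2 * ((n : ℝ) + 1)⁻¹) := by
    intro l _
    refine (hmul _ _).trans (mul_le_mul ?_ (N.sum_inv_smul_sub_le _ (hx1 _) h)
      (apply_nonneg N _) (by norm_num))
    refine (map_sub_le_add N _ _).trans ?_
    linarith [hg (l + 1)]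
  refine (Finset.sum_le_sum this).trans (le_of_eq ?_)
  rw [Finset.sum_const, Finset.card_range, nsmul_eq_mul]
  ring

end Comparison

/-! ### Coloured cycle counts and their Poisson limit -/

section L1

variable {ι : Type*}

theorem MvPolynomial.sum_abs_coeff_of_support_subset (p : MvPolynomial ι ℝ)
    {s : Finset (ι →₀ ℕ)} (h : p.support ⊆ s) :
    ∑ a ∈ p.support, |p.coeff a| = ∑ a ∈ s, |p.coeff a| := by
  refine Finset.sum_subset h fun a _ ha => ?_
  rw [MvPolynomial.notMem_support_iff.1 ha, abs_zero]

/-- The `ℓ¹` norm of the coefficients of a polynomial. -/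
noncomputable def coeffL1 (ι : Type*) : Seminorm ℝ (MvPolynomial ι ℝ) :=
  Seminorm.of (fun p => ∑ a ∈ p.support, |p.coeff a|)
    (by
      classical
      intro p q
      rw [(p + q).sum_abs_coeff_of_support_subset MvPolynomial.support_add,
        p.sum_abs_coeff_of_support_subset Finset.subset_union_left,
        q.sum_abs_coeff_of_support_subset Finset.subset_union_right, ← Finset.sum_add_distrib]
      refine Finset.sum_le_sum fun a _ => ?_
      rw [MvPolynomial.coeff_add]
      exact abs_add_le _ _)
    (by
      intro c p
      rw [(c • p).sum_abs_coeff_of_support_subset MvPolynomial.support_smul, Finset.mul_sum]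
      refine Finset.sum_congr rfl fun a _ => ?_
      rw [MvPolynomial.coeff_smul, smul_eq_mul, abs_mul, Real.norm_eq_abs])

theorem coeffL1_apply (p : MvPolynomial ι ℝ) :
    coeffL1 ι p = ∑ a ∈ p.support, |p.coeff a| := rfl

theorem coeffL1_monomial (a : ι →₀ ℕ) (c : ℝ) :
    coeffL1 ι (MvPolynomial.monomial a c) = |c| := by
  classical
  rw [coeffL1_apply,
    MvPolynomial.sum_abs_coeff_of_support_subset _ MvPolynomial.support_monomial_subset]
  simp

theorem coeffL1_one : coeffL1 ι 1 = 1 := by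
  rw [← MvPolynomial.C_1, MvPolynomial.C_apply, coeffL1_monomial, abs_one]

theorem coeffL1_mul_le (p q : MvPolynomial ι ℝ) :
    coeffL1 ι (p * q) ≤ coeffL1 ι p * coeffL1 ι q := by
  conv_lhs => rw [p.as_sum, q.as_sum, Finset.sum_mul_sum]
  rw [coeffL1_apply p, coeffL1_apply q, Finset.sum_mul_sum]
  refine (Finset.le_sum_of_subadditive _ (map_zero _).le (map_add_le_add _) _ _).trans
    (Finset.sum_le_sum fun a _ => ?_)
  refine (Finset.le_sum_of_subadditive _ (map_zero _).le (map_add_le_add _) _ _).trans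
    (Finset.sum_le_sum fun b _ => ?_)
  rw [MvPolynomial.monomial_mul, coeffL1_monomial, abs_mul]

theorem sum_abs_coeff_le_coeffL1 (p : MvPolynomial ι ℝ) (s : Finset (ι →₀ ℕ)) :
    ∑ a ∈ s, |p.coeff a| ≤ coeffL1 ι p := by
  classical
  rw [coeffL1_apply, p.sum_abs_coeff_of_support_subset Finset.subset_union_right]
  exact Finset.sum_le_sum_of_subset_of_nonneg Finset.subset_union_left fun _ _ _ => abs_nonneg _

theorem eval_one_eq_sum_coeff (p : MvPolynomial ι ℝ) {s : Finset (ι →₀ ℕ)} (h : p.support ⊆ s) :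
    MvPolynomial.eval (fun _ => 1) p = ∑ a ∈ s, p.coeff a := by
  rw [MvPolynomial.eval_eq]
  simp only [one_pow, Finset.prod_const_one, mul_one]
  exact Finset.sum_subset h fun a _ ha => MvPolynomial.notMem_support_iff.1 ha

/-- If the coefficients sum to zero, the positive ones carry half of the `ℓ¹` norm. -/
theorem two_mul_sum_coeff_le (p : MvPolynomial ι ℝ) (hp : MvPolynomial.eval (fun _ => 1) p = 0)
    (s : Finset (ι →₀ ℕ)) : 2 * ∑ a ∈ s, p.coeff a ≤ coeffL1 ι p := by
  classical
  rw [eval_one_eq_sum_coeff p (Finset.subset_union_right (s₁ := s))] at hp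
  rw [coeffL1_apply, p.sum_abs_coeff_of_support_subset (Finset.subset_union_right (s₁ := s))]
  have hs := Finset.subset_union_left (s₁ := s) (s₂ := p.support)
  rw [← Finset.sum_sdiff hs] at hp ⊢
  have h1 : ∑ a ∈ s, p.coeff a ≤ ∑ a ∈ s, |p.coeff a| := Finset.sum_le_sum fun _ _ => le_abs_self _
  have h2 : -∑ a ∈ (s ∪ p.support) \ s, p.coeff a ≤ ∑ a ∈ (s ∪ p.support) \ s, |p.coeff a| := by
    rw [← Finset.sum_neg_distrib]
    exact Finset.sum_le_sum fun _ _ => neg_le_abs _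
  linarith

end L1

/-- The recursion `q(a + eᵢ) (aᵢ + 1) = rᵢ q(a)` determines `q` up to a factor. -/
theorem mul_eq_mul_of_recursion {ι : Type*} {q L : (ι →₀ ℕ) → ℝ} {r : ι → ℝ}
    (hq : ∀ (i : ι) (a : ι →₀ ℕ),
      q (a + Finsupp.single i 1) * ((a i : ℝ) + 1) = r i * q a)
    (hL : ∀ (i : ι) (a : ι →₀ ℕ),
      L (a + Finsupp.single i 1) * ((a i : ℝ) + 1) = r i * L a) (a : ι →₀ ℕ) :
    L a * q 0 = L 0 * q a := by
  classical
  induction hd : a.degree using Nat.strong_induction_on generalizing a with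
  | _ d ih =>
    by_cases ha : a = 0
    · rw [ha]
    · obtain ⟨i, hi⟩ := Finsupp.ne_iff.1 ha
      have hle : Finsupp.single i 1 ≤ a :=
        Finsupp.single_le_iff.2 (Nat.one_le_iff_ne_zero.2 hi)
      obtain ⟨c, rfl⟩ := exists_add_of_le hle
      rw [add_comm] at hd ⊢
      have h0 : ((c i : ℝ) + 1) ≠ 0 := by positivity
      have := ih c.degree (by rw [← hd, map_add]; simp) c rfl
      have h1 := hq i c
      have h2 := hL i c
      apply mul_right_cancel₀ h0
      linear_combination q 0 * h2 - L 0 * h1 + r i * this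

section Limit

variable {ι : Type*} [Fintype ι]

/-- Weights for the generating function of the numbers `aᵢ` of cycles of length `len i` and
colour `i`, where a cycle of length `l ≤ b` receives one of the colours `i` with `len i = l`,
with probability `p i`. Cycles longer than `b` are not recorded and have weight `1`. -/
noncomputable def colourWeight (len : ι → ℕ) (p : ι → ℝ) (b l : ℕ) : MvPolynomial ι ℝ :=
  if l ∈ Finset.Icc 1 b then
    ∑ i with len i = l, MvPolynomial.monomial (Finsupp.single i 1) (p i) else 1

variable {len : ι → ℕ} {p : ι → ℝ} {b : ℕ}

theorem coeffL1_colourWeight_le (hp : ∀ i, 0 ≤ p i)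
    (hsum : ∀ l ∈ Finset.Icc 1 b, ∑ i with len i = l, p i = 1) (l : ℕ) :
    coeffL1 ι (colourWeight len p b l) ≤ 1 := by
  rw [colourWeight]
  split_ifs with h
  · refine (Finset.le_sum_of_subadditive _ (map_zero _).le (map_add_le_add _) _ _).trans ?_
    simp only [coeffL1_monomial, abs_of_nonneg (hp _)]
    exact (hsum l h).le
  · exact coeffL1_one.le

theorem eval_one_cycleIndex_colourWeight
    (hsum : ∀ l ∈ Finset.Icc 1 b, ∑ i with len i = l, p i = 1) (n : ℕ) :
    MvPolynomial.eval (fun _ => 1) (cycleIndex (colourWeight len p b) n) = 1 := by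
  have h1 : ∀ l, MvPolynomial.aeval (fun _ => (1 : ℝ)) (colourWeight len p b l) = 1 := by
    intro l
    rw [colourWeight]
    split_ifs with h
    · simp [MvPolynomial.aeval_monomial, hsum l h]
    · simp
  have h2 := sum_prod_partition_eq (fun _ => (1 : ℝ)) n
  have h3 : (n.factorial : ℝ) ≠ 0 := by positivity
  rw [← MvPolynomial.coe_aeval_eq_eval, RingHom.coe_coe, map_cycleIndex]
  simp only [h1]
  simp only [Multiset.map_const', Multiset.prod_replicate, one_pow, Finset.sum_const,
    Finset.card_univ, Fintype.card_perm, Fintype.card_fin, nsmul_eq_mul, mul_one, smul_eq_mul] at h2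
  exact mul_left_cancel₀ h3 (by rw [← h2, mul_one])

/-- The expected number of cycles of colour `i`, on an event for the counts, equals `p i / len i`
times the probability of that event, shifted, for a permutation with `len i` fewer points. -/
theorem coeff_add_single_cycleIndex (hlen : ∀ i, len i ∈ Finset.Icc 1 b) (i : ι) (a : ι →₀ ℕ)
    (n : ℕ) :
    (cycleIndex (colourWeight len p b) (n + len i)).coeff (a + Finsupp.single i 1) * (a i + 1) =
      p i / len i * (cycleIndex (colourWeight len p b) n).coeff a := by
  classical
  rw [← MvPolynomial.coeff_pderiv, derivation_cycleIndex, Finset.sum_eq_single (len i, n)]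
  · have : MvPolynomial.pderiv i (colourWeight len p b (len i)) = MvPolynomial.C (p i) := by
      rw [colourWeight, if_pos (hlen i), map_sum, Finset.sum_eq_single i]
      · simp [MvPolynomial.pderiv_monomial, ← MvPolynomial.C_apply]
      · intro j _ hj
        simp [MvPolynomial.pderiv_monomial, hj]
      · simp
    simp only [this]
    rw [smul_mul_assoc, MvPolynomial.coeff_smul, MvPolynomial.coeff_C_mul, smul_eq_mul]
    ring
  · rintro ⟨l, m⟩ hq hne
    have hl : l ≠ len i := by
      rintro rfl
      have := Finset.HasAntidiagonal.mem_antidiagonal.1 hq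
      simp only at this
      exact hne (by rw [show m = n by omega])
    have : MvPolynomial.pderiv i (colourWeight len p b l) = 0 := by
      rw [colourWeight]
      split_ifs with h
      · rw [map_sum]
        refine Finset.sum_eq_zero fun j hj => ?_
        have hj' : j ≠ i := by
          rintro rfl
          exact hl (Finset.mem_filter.1 hj).2.symm
        simp [MvPolynomial.pderiv_monomial, hj']
      · simp
    simp [this]
  · intro h
    exact absurd (Finset.HasAntidiagonal.mem_antidiagonal.2 (by simp; omega)) h

theorem coeffL1_cycleIndex_sub_le (hp : ∀ i, 0 ≤ p i)
    (hsum : ∀ l ∈ Finset.Icc 1 b, ∑ i with len i = l, p i = 1) {n M : ℕ} (h : n ≤ M) :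
    coeffL1 ι (cycleIndex (colourWeight len p b) M - cycleIndex (colourWeight len p b) n) ≤
      4 * b / ((n : ℝ) + 1) := by
  refine (coeffL1 ι).cycleIndex_sub_le coeffL1_mul_le coeffL1_one.le
    (coeffL1_colourWeight_le hp hsum) (fun l hl => ?_) h
  rw [colourWeight, if_neg (by simp; omega)]

theorem sum_coeff_sub_coeff_le (hp : ∀ i, 0 ≤ p i)
    (hsum : ∀ l ∈ Finset.Icc 1 b, ∑ i with len i = l, p i = 1) {n M : ℕ} (h : n ≤ M)
    (s : Finset (ι →₀ ℕ)) :
    ∑ a ∈ s, ((cycleIndex (colourWeight len p b) n).coeff a -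
      (cycleIndex (colourWeight len p b) M).coeff a) ≤ 2 * b / ((n : ℝ) + 1) := by
  have h1 := coeffL1_cycleIndex_sub_le hp hsum h
  rw [map_sub_rev] at h1
  have h2 := two_mul_sum_coeff_le (cycleIndex (colourWeight len p b) n -
    cycleIndex (colourWeight len p b) M)
    (by rw [map_sub, eval_one_cycleIndex_colourWeight hsum,
      eval_one_cycleIndex_colourWeight hsum, sub_self]) s
  simp only [MvPolynomial.coeff_sub] at h2
  have h3 : 4 * (b : ℝ) / ((n : ℝ) + 1) = 2 * (2 * b / ((n : ℝ) + 1)) := by ring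
  linarith

theorem exists_tendsto_coeff_cycleIndex (hp : ∀ i, 0 ≤ p i)
    (hsum : ∀ l ∈ Finset.Icc 1 b, ∑ i with len i = l, p i = 1) (a : ι →₀ ℕ) :
    ∃ L, Filter.Tendsto (fun n => (cycleIndex (colourWeight len p b) n).coeff a)
      Filter.atTop (nhds L) := by
  have h1 : ∀ n M, n ≤ M → dist ((cycleIndex (colourWeight len p b) n).coeff a)
      ((cycleIndex (colourWeight len p b) M).coeff a) ≤ 4 * b / ((n : ℝ) + 1) := by
    intro n M h
    have h1 := coeffL1_cycleIndex_sub_le hp hsum h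
    refine le_trans ?_ ((sum_abs_coeff_le_coeffL1 _ {a}).trans h1)
    rw [Finset.sum_singleton, MvPolynomial.coeff_sub, dist_comm, Real.dist_eq]
  refine cauchySeq_tendsto_of_complete (cauchySeq_of_le_tendsto_0
    (fun n : ℕ => 4 * b / ((n : ℝ) + 1)) (fun n m K hn hm => ?_) ?_)
  · rcases le_total n m with h | h
    · exact (h1 n m h).trans (by gcongr)
    · rw [dist_comm]
      exact (h1 m n h).trans (by gcongr)
  · simpa [div_eq_mul_inv] using
      (tendsto_one_div_add_atTop_nhds_zero_nat (𝕜 := ℝ)).const_mul (4 * (b : ℝ))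

/-- The law of the coloured cycle counts is within `2 * b / (n + 1)` of any probability `q`
satisfying the recursion of the Poisson weights: the coefficients of the cycle indices converge,
the limit satisfies that recursion by `coeff_add_single_cycleIndex`, and no mass is lost. -/
theorem sum_coeff_cycleIndex_sub_le (hp : ∀ i, 0 ≤ p i) (hlen : ∀ i, len i ∈ Finset.Icc 1 b)
    (hsum : ∀ l ∈ Finset.Icc 1 b, ∑ i with len i = l, p i = 1)
    {q : (ι →₀ ℕ) → ℝ} (hq0 : ∀ a, 0 ≤ q a) (hq00 : q 0 ≠ 0) (hq1 : HasSum q 1)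
    (hq : ∀ (i : ι) (a : ι →₀ ℕ),
      q (a + Finsupp.single i 1) * ((a i : ℝ) + 1) = p i / len i * q a)
    (n : ℕ) (s : Finset (ι →₀ ℕ)) :
    ∑ a ∈ s, ((cycleIndex (colourWeight len p b) n).coeff a - q a) ≤ 2 * b / ((n : ℝ) + 1) := by
  choose L hL using exists_tendsto_coeff_cycleIndex hp hsum
  have hLrec : ∀ (i : ι) (a : ι →₀ ℕ),
      L (a + Finsupp.single i 1) * ((a i : ℝ) + 1) = p i / len i * L a := by
    intro i a
    have h1 := ((hL (a + Finsupp.single i 1)).comp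
      (Filter.tendsto_add_atTop_nat (len i))).mul_const ((a i : ℝ) + 1)
    have h2 := (hL a).const_mul (p i / len i)
    refine tendsto_nhds_unique h1 (h2.congr fun n => ?_)
    exact (coeff_add_single_cycleIndex hlen i a n).symm
  have hcross := mul_eq_mul_of_recursion hq hLrec
  set c := L 0 / q 0 with hc
  have hLq : ∀ a, L a = c * q a := by
    intro a
    rw [hc, div_mul_eq_mul_div, eq_div_iff hq00, hcross]
  have hlim : ∀ (m : ℕ) (t : Finset (ι →₀ ℕ)),
      ∑ a ∈ t, ((cycleIndex (colourWeight len p b) m).coeff a - L a) ≤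
        2 * b / ((m : ℝ) + 1) := by
    intro m t
    refine le_of_tendsto (tendsto_finsetSum t fun a _ => tendsto_const_nhds.sub (hL a)) ?_
    filter_upwards [Filter.eventually_ge_atTop m] with M hM
    exact sum_coeff_sub_coeff_le hp hsum hM t
  -- the limit is a subprobability by Fatou's argument on finite sets
  have hc_le : c ≤ 1 := by
    refine le_of_tendsto (f := fun t : Finset (ι →₀ ℕ) => c * ∑ a ∈ t, q a)
      (by simpa using Filter.Tendsto.const_mul c hq1) (Filter.Eventually.of_forall fun t => ?_)
    rw [Finset.mul_sum]
    simp only [← hLq]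
    refine le_of_tendsto (tendsto_finsetSum t fun a _ => hL a) (Filter.Eventually.of_forall ?_)
    intro m
    refine (Finset.sum_le_sum fun a _ => le_abs_self _).trans
      ((sum_abs_coeff_le_coeffL1 _ t).trans ?_)
    exact (coeffL1 ι).cycleIndex_le_one coeffL1_mul_le coeffL1_one.le
      (coeffL1_colourWeight_le hp hsum) m
  -- up to `2 * b / (m + 1)`, the limit charges the finite support of the `m`-th law fully
  have hlow : ∀ m : ℕ, ∃ S : ℝ, 0 ≤ S ∧ S ≤ 1 ∧ 1 - 2 * b / ((m : ℝ) + 1) ≤ c * S := by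
    intro m
    refine ⟨∑ a ∈ (cycleIndex (colourWeight len p b) m).support, q a,
      Finset.sum_nonneg fun _ _ => hq0 _, sum_le_hasSum _ (fun _ _ => hq0 _) hq1, ?_⟩
    have h1 := hlim m (cycleIndex (colourWeight len p b) m).support
    rw [Finset.sum_sub_distrib, ← eval_one_eq_sum_coeff _ subset_rfl,
      eval_one_cycleIndex_colourWeight hsum] at h1
    simp only [hLq, ← Finset.mul_sum] at h1
    linarith
  have htend : Filter.Tendsto (fun m : ℕ => 1 - 2 * (b : ℝ) / ((m : ℝ) + 1)) Filter.atTop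
      (nhds 1) := by
    simpa [div_eq_mul_inv] using
      ((tendsto_one_div_add_atTop_nhds_zero_nat (𝕜 := ℝ)).const_mul (2 * (b : ℝ))).const_sub 1
  have hc_pos : 0 < c := by
    obtain ⟨m, hm⟩ := (htend.eventually (lt_mem_nhds (show (0 : ℝ) < 1 by norm_num))).exists
    obtain ⟨S, h0, -, h2⟩ := hlow m
    exact pos_of_mul_pos_left (hm.trans_le h2) h0
  have hc_ge : 1 ≤ c := by
    refine le_of_tendsto htend (Filter.Eventually.of_forall fun m => ?_)
    obtain ⟨S, -, h1, h2⟩ := hlow m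
    nlinarith
  have hc1 : c = 1 := le_antisymm hc_le hc_ge
  simpa only [hLq, hc1, one_mul] using hlim n s

end Limit

/-! ### Cycles of elements of a wreath product -/

section CycleLengths

variable {α : Type*} [Fintype α] [DecidableEq α]

open Function (minimalPeriod)

/-- The cycles of a permutation, fixed points included. -/
abbrev CycleClass {α : Type*} (σ : Equiv.Perm α) : Type _ :=
  Quotient (Equiv.Perm.SameCycle.setoid σ)

theorem mem_periodicPts_perm {α : Type*} [Finite α] (σ : Equiv.Perm α) (x : α) :
    x ∈ Function.periodicPts σ :=
  Function.mk_mem_periodicPts (orderOf_pos σ) (by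
    rw [Function.IsPeriodicPt, Function.IsFixedPt, Equiv.Perm.iterate_eq_pow, pow_orderOf_eq_one]
    rfl)

open scoped Classical in
theorem card_sameCycle_eq_minimalPeriod (σ : Equiv.Perm α) (x : α) :
    Finset.card {y | σ.SameCycle x y} = minimalPeriod σ x := by
  have hs : σ.IsCycleOn (↑({y | σ.SameCycle x y} : Finset α)) := by
    refine ⟨⟨?_, σ.injective.injOn, ?_⟩, ?_⟩
    · intro y hy
      simpa using hy
    · intro y hy
      refine ⟨σ⁻¹ y, ?_, by simp⟩
      simpa using hy
    · intro y hy z hz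
      simp only [Finset.coe_filter, Finset.mem_univ, true_and, Set.mem_ofPred_eq] at hy hz
      exact hy.symm.trans hz
  have h : ∀ n, minimalPeriod σ x ∣ n ↔ Finset.card {y | σ.SameCycle x y} ∣ n := by
    intro n
    rw [← hs.pow_apply_eq (a := x) (by simp [Equiv.Perm.SameCycle.refl]),
      ← Function.isPeriodicPt_iff_minimalPeriod_dvd,
      Function.IsPeriodicPt, Function.IsFixedPt, Equiv.Perm.iterate_eq_pow]
  exact Nat.dvd_antisymm ((h _).1 dvd_rfl) ((h _).2 dvd_rfl)

/-- The points lying in `d`-cycles are `d` times as many as the `d`-cycles. -/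
theorem card_minimalPeriod_eq (σ : Equiv.Perm α) (d : ℕ) :
    Finset.card {x | minimalPeriod σ x = d} = d * cycleCount σ d := by
  classical
  rw [cycleCount, Equiv.Perm.parts_partition, Multiset.count_add, Multiset.count_replicate]
  rcases Nat.lt_trichotomy d 1 with hd | rfl | hd
  · obtain rfl : d = 0 := by omega
    rw [zero_mul, Finset.card_eq_zero, Finset.filter_eq_empty_iff]
    intro x _
    exact (Function.minimalPeriod_pos_of_mem_periodicPts (mem_periodicPts_perm σ x)).ne'
  · rw [Multiset.count_eq_zero_of_notMem fun h =>
      absurd (Equiv.Perm.two_le_of_mem_cycleType h) (by norm_num)]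
    simp only [if_true, zero_add, one_mul]
    rw [← Finset.card_compl]
    congr 1
    ext x
    simp [Function.minimalPeriod_eq_one_iff_isFixedPt, Function.IsFixedPt]
  · rw [if_neg (by omega), add_zero, Equiv.Perm.cycleType_def, Multiset.count_map]
    have hmem : ∀ c ∈ σ.cycleFactorsFinset, ∀ x, x ∈ c.support →
        minimalPeriod σ x = c.support.card := by
      intro c hc x hx
      have hx' : σ x ≠ x := by
        rw [← (Equiv.Perm.mem_cycleFactorsFinset_iff.1 hc).2 x hx]
        exact Equiv.Perm.mem_support.1 hx
      rw [← card_sameCycle_eq_minimalPeriod, Equiv.Perm.cycle_is_cycleOf hx hc]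
      congr 1
      ext y
      rw [Equiv.Perm.mem_support_cycleOf_iff' hx']
      simp
    have hfix : ∀ x, minimalPeriod σ x = d → σ x ≠ x := by
      intro x hx h
      have := Function.minimalPeriod_eq_one_iff_isFixedPt.2 h
      omega
    rw [Finset.card_eq_sum_card_fiberwise (f := σ.cycleOf)
      (t := {c ∈ σ.cycleFactorsFinset | d = c.support.card})]
    · rw [Finset.sum_const_nat (m := d), mul_comm]
      · rfl
      · intro c hc
        obtain ⟨hc, hcd⟩ := Finset.mem_filter.1 hc
        refine Eq.trans (congrArg Finset.card ?_) hcd.symm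
        ext x
        simp only [Finset.mem_filter, Finset.mem_univ, true_and]
        constructor
        · rintro ⟨h1, rfl⟩
          rw [Equiv.Perm.mem_support_cycleOf_iff' (hfix x h1)]
        · intro hx
          exact ⟨(hmem c hc x hx).trans hcd.symm, (Equiv.Perm.cycle_is_cycleOf hx hc).symm⟩
    · intro x hx
      have hx : minimalPeriod σ x = d := by simpa using hx
      have h1 : σ.cycleOf x ∈ σ.cycleFactorsFinset :=
        Equiv.Perm.cycleOf_mem_cycleFactorsFinset_iff.2 (Equiv.Perm.mem_support.2 (hfix x hx))
      have h2 : x ∈ (σ.cycleOf x).support :=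
        (Equiv.Perm.mem_support_cycleOf_iff' (hfix x hx)).2 (Equiv.Perm.SameCycle.refl _ _)
      simp only [Finset.coe_filter, Set.mem_ofPred_eq]
      exact ⟨h1, by rw [← hmem _ h1 x h2, hx]⟩

open scoped Classical in
/-- Summing over the points of a permuted set a quantity that is constant on cycles. -/
theorem sum_eq_sum_cycles {M : Type*} [AddCommMonoid M] (σ : Equiv.Perm α) (f : α → M)
    (hf : ∀ x, f (σ x) = f x) :
    ∑ x, f x = ∑ q : CycleClass σ,
      minimalPeriod σ q.out • f q.out := by
  have hf' : ∀ x y, σ.SameCycle x y → f x = f y := by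
    intro x y h
    obtain ⟨m, rfl⟩ := h.exists_nat_pow_eq
    induction m with
    | zero => rfl
    | succ m ih =>
      rw [pow_succ', Equiv.Perm.mul_apply, hf]
      exact ih ⟨m, by simp⟩
  rw [← Finset.sum_fiberwise (g := fun x => (Quotient.mk (Equiv.Perm.SameCycle.setoid σ) x))]
  refine Finset.sum_congr rfl fun q _ => ?_
  have hiff : ∀ x, Quotient.mk (Equiv.Perm.SameCycle.setoid σ) x = q ↔ σ.SameCycle q.out x := by
    intro x
    conv_lhs => rw [← Quotient.out_eq q]
    rw [Quotient.eq]
    exact Equiv.Perm.sameCycle_comm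
  rw [← card_sameCycle_eq_minimalPeriod, ← Finset.sum_const]
  simp only [hiff]
  exact Finset.sum_congr rfl fun x hx => (hf' _ _ (Finset.mem_filter.1 hx).2).symm

open scoped Classical in
theorem parts_partition_eq_map_minimalPeriod (σ : Equiv.Perm α) :
    σ.partition.parts = (Finset.univ : Finset (CycleClass σ)).val.map
      fun q => minimalPeriod σ q.out := by
  ext d
  rw [Multiset.count_map]
  have h1 := card_minimalPeriod_eq σ d
  rw [Finset.card_filter, sum_eq_sum_cycles σ _ fun x => by
    rw [Function.minimalPeriod_apply (mem_periodicPts_perm σ x)]] at h1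
  have h2 : ∀ q : CycleClass σ, minimalPeriod σ q.out •
      (if minimalPeriod σ q.out = d then 1 else 0) =
      d * (if minimalPeriod σ q.out = d then 1 else 0) := by
    intro q
    split_ifs with h <;> simp [h]
  simp only [h2, ← Finset.mul_sum, ← Finset.card_filter] at h1
  rcases Nat.eq_zero_or_pos d with rfl | hd
  · rw [Multiset.count_eq_zero_of_notMem fun h => (σ.partition.parts_pos h).ne rfl]
    symm
    rw [Multiset.card_eq_zero, Multiset.filter_eq_nil]
    intro q _
    exact (Function.minimalPeriod_pos_of_mem_periodicPts (mem_periodicPts_perm σ _)).ne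
  · rw [cycleCount] at h1
    rw [← Nat.eq_of_mul_eq_mul_left hd h1]
    simp only [eq_comm (a := d)]
    rfl

end CycleLengths

section WreathProduct

open Function (minimalPeriod)

variable {α : Type*}

/-- The product `γ (h^(m-1) i) * ⋯ * γ (h i) * γ i` along the first `m` steps of the orbit
of `i`. -/
def cocycle {G : Type*} [Monoid G] (h : Equiv.Perm α) (γ : α → G) : ℕ → α → G
  | 0, _ => 1
  | m + 1, i => γ (h^[m] i) * cocycle h γ m i

/-- The cycle product at `i`: the product of the `γ`'s along the cycle of `h` through `i`. -/
noncomputable def cycleProduct {G : Type*} [Monoid G] (h : Equiv.Perm α) (γ : α → G) (i : α) : G :=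
  cocycle h γ (minimalPeriod h i) i

theorem map_cocycle {G G' : Type*} [Monoid G] [Monoid G'] (f : G →* G') (h : Equiv.Perm α)
    (γ : α → G) (m : ℕ) (i : α) : f (cocycle h γ m i) = cocycle h (fun j => f (γ j)) m i := by
  induction m with
  | zero => exact map_one f
  | succ m ih => rw [cocycle, cocycle, map_mul, ih]

theorem prodShear_iterate {β : Type*} (h : Equiv.Perm α) (γ : α → Equiv.Perm β) (m : ℕ) (i : α)
    (x : β) : (Equiv.prodShear h γ)^[m] (i, x) = (h^[m] i, cocycle h γ m i x) := by
  induction m with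
  | zero => rfl
  | succ m ih =>
    rw [Function.iterate_succ_apply', ih, Function.iterate_succ_apply']
    rfl

/-- A point `x` of the block `i` first returns to its block after one turn of the block cycle, and
is then moved by the cycle product. -/
theorem minimalPeriod_prodShear [Finite α] {β : Type*} (h : Equiv.Perm α) (γ : α → Equiv.Perm β)
    (i : α) (x : β) :
    minimalPeriod (Equiv.prodShear h γ) (i, x) =
      minimalPeriod h i * minimalPeriod (cycleProduct h γ i : Equiv.Perm β) x := by
  set σ : Equiv.Perm (α × β) := Equiv.prodShear h γ with hσ
  have hpos := Function.minimalPeriod_pos_of_mem_periodicPts (mem_periodicPts_perm h i)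
  have hdvd : minimalPeriod h i ∣ minimalPeriod σ (i, x) := by
    apply Function.IsPeriodicPt.minimalPeriod_dvd
    have := Function.iterate_minimalPeriod (f := σ) (x := (i, x))
    rw [hσ, prodShear_iterate] at this
    exact congrArg Prod.fst this
  have hret : ∀ m, (σ^[minimalPeriod h i])^[m] (i, x) =
      (i, (cycleProduct h γ i : Equiv.Perm β)^[m] x) := by
    intro m
    induction m with
    | zero => rfl
    | succ m ih =>
      rw [Function.iterate_succ_apply', ih, hσ, prodShear_iterate, Function.iterate_minimalPeriod,
        Function.iterate_succ_apply']
      rfl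
  have heq : minimalPeriod (σ^[minimalPeriod h i]) (i, x) =
      minimalPeriod (cycleProduct h γ i : Equiv.Perm β) x := by
    refine Function.minimalPeriod_eq_minimalPeriod_iff.2 fun m => ?_
    rw [Function.IsPeriodicPt, Function.IsFixedPt, hret, Function.IsPeriodicPt,
      Function.IsFixedPt, Prod.mk.injEq, and_iff_right rfl]
  rw [Function.minimalPeriod_iterate_eq_div_gcd hpos.ne', Nat.gcd_eq_right hdvd] at heq
  rw [← heq, Nat.mul_div_cancel' hdvd]

/-- Changing `γ` only at the starting point of the orbit multiplies the cocycle on the right. -/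
theorem cocycle_mul_eq {G : Type*} [Group G] (h : Equiv.Perm α) (γ ε : α → G) (i : α)
    (hε : ∀ m, 0 < m → m < minimalPeriod h i → ε (h^[m] i) = 1) {m : ℕ}
    (hm : m + 1 ≤ minimalPeriod h i) :
    cocycle h (γ * ε) (m + 1) i = cocycle h γ (m + 1) i * ε i := by
  induction m with
  | zero => simp [cocycle]
  | succ m ih =>
    have hstep : ∀ γ' : α → G, cocycle h γ' (m + 1 + 1) i =
        γ' (h^[m + 1] i) * cocycle h γ' (m + 1) i := fun _ => rfl
    rw [hstep, hstep, ih (by omega), Pi.mul_apply, hε (m + 1) (by omega) (by omega), mul_one,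
      mul_assoc]

variable [Fintype α] [DecidableEq α] {β : Type*} [Fintype β] [DecidableEq β]

/-- The number of `d`-cycles contributed by a block cycle of length `l` with cycle product `ρ`. -/
def blockCycleCount (l : ℕ) (ρ : Equiv.Perm β) (d : ℕ) : ℕ :=
  if l ∣ d then cycleCount ρ (d / l) else 0

open scoped Classical in
theorem cycleCount_prodShear (h : Equiv.Perm α) (γ : α → Equiv.Perm β) {d : ℕ} (hd : 0 < d) :
    cycleCount (Equiv.prodShear h γ : Equiv.Perm (α × β)) d =
      ∑ q : CycleClass h,
        blockCycleCount (minimalPeriod h q.out) (cycleProduct h γ q.out) d := by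
  set σ : Equiv.Perm (α × β) := Equiv.prodShear h γ with hσ
  apply Nat.eq_of_mul_eq_mul_left hd
  rw [← card_minimalPeriod_eq, Finset.card_filter, Fintype.sum_prod_type,
    sum_eq_sum_cycles h, Finset.mul_sum]
  · refine Finset.sum_congr rfl fun q _ => ?_
    rw [← Finset.card_filter]
    simp only [hσ, minimalPeriod_prodShear]
    rw [blockCycleCount, smul_eq_mul]
    have hpos := Function.minimalPeriod_pos_of_mem_periodicPts (mem_periodicPts_perm h q.out)
    split_ifs with hl
    · have : ∀ x,
          minimalPeriod h q.out * minimalPeriod (cycleProduct h γ q.out : Equiv.Perm β) x = d ↔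
          minimalPeriod (cycleProduct h γ q.out : Equiv.Perm β) x = d / minimalPeriod h q.out := by
        intro x
        rw [Nat.eq_div_iff_mul_eq_left hpos.ne' hl, mul_comm, eq_comm]
      simp only [this]
      rw [card_minimalPeriod_eq, ← mul_assoc, Nat.mul_div_cancel' hl]
    · rw [mul_zero, mul_eq_zero]
      right
      rw [Finset.card_eq_zero, Finset.filter_eq_empty_iff]
      intro x _ hx
      exact hl ⟨_, hx.symm⟩
  · intro i
    rw [← Equiv.sum_comp (γ i)]
    refine Finset.sum_congr rfl fun x _ => ?_
    rw [← Function.minimalPeriod_apply (mem_periodicPts_perm σ (i, x))]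
    rfl

open scoped Classical in
/-- For uniform `γ`, the cycle products are independent and uniform. -/
theorem sum_cycleProduct {G : Type*} [Group G] [Fintype G] {M : Type*} [AddCommMonoid M]
    (h : Equiv.Perm α) (F : (CycleClass h → G) → M) :
    Fintype.card (CycleClass h → G) •
        ∑ γ : α → G, F (fun q => cycleProduct h γ q.out) =
      Fintype.card (α → G) • ∑ ρ, F ρ := by
  -- multiplying `γ` by `δ` at one chosen block of each cycle multiplies the cycle products by `δ`
  let ε : (CycleClass h → G) → α → G := fun δ i =>
    if i = (Quotient.mk (Equiv.Perm.SameCycle.setoid h) i).out then δ (Quotient.mk _ i) else 1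
  have hε : ∀ δ γ, (fun q : CycleClass h => cycleProduct h (γ * ε δ) q.out) =
      (fun q : CycleClass h => cycleProduct h γ q.out) * δ := by
    intro δ γ
    funext q
    have hpos := Function.minimalPeriod_pos_of_mem_periodicPts (mem_periodicPts_perm h q.out)
    have hq : ε δ q.out = δ q := by simp [ε]
    rw [Pi.mul_apply, ← hq, cycleProduct, cycleProduct, ← Nat.sub_add_cancel hpos]
    refine cocycle_mul_eq h γ (ε δ) _ ?_ (by omega)
    intro m hm hm'
    have hmk : Quotient.mk (Equiv.Perm.SameCycle.setoid h) (h^[m] q.out) = q := by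
      conv_rhs => rw [← Quotient.out_eq q]
      refine Quotient.sound ?_
      rw [Equiv.Perm.iterate_eq_pow]
      exact Equiv.Perm.SameCycle.symm ⟨m, by simp⟩
    simp only [ε, hmk]
    rw [if_neg]
    intro heq
    exact Function.not_isPeriodicPt_of_pos_of_lt_minimalPeriod hm.ne' hm' heq
  have h1 : ∀ δ : CycleClass h → G, ∑ γ : α → G, F (fun q => cycleProduct h γ q.out) =
      ∑ γ : α → G, F ((fun q : CycleClass h => cycleProduct h γ q.out) * δ) := by
    intro δ
    rw [← Equiv.sum_comp (Equiv.mulRight (ε δ))]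
    simp only [Equiv.coe_mulRight, hε]
  have h2 : ∀ ρ : CycleClass h → G, ∑ δ : CycleClass h → G, F (ρ * δ) = ∑ δ, F δ := fun ρ =>
    Equiv.sum_comp (Equiv.mulLeft ρ) F
  calc _ = ∑ δ : CycleClass h → G, ∑ γ : α → G, F (fun q => cycleProduct h γ q.out) := by
        rw [Finset.sum_const, Finset.card_univ]
    _ = ∑ δ : CycleClass h → G, ∑ γ : α → G,
          F ((fun q : CycleClass h => cycleProduct h γ q.out) * δ) :=
        Finset.sum_congr rfl fun δ _ => h1 δ
    _ = _ := by
        rw [Finset.sum_comm]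
        simp only [h2]
        rw [Finset.sum_const, Finset.card_univ]

end WreathProduct

/-! ### The law of the cycle counts of the wreath product -/

section WreathLaw

open Function (minimalPeriod)

variable {k : ℕ} (Γ : Subgroup (Equiv.Perm (Fin k)))

/-- For `1 ≤ d ≤ b`, the number of `d`-cycles contributed by a block cycle of length `l` whose
cycle product has cycle type `lam`. -/
noncomputable def typeCycleVec (b l : ℕ) (lam : k.Partition) : Finset.Icc 1 b →₀ ℕ :=
  Finsupp.equivFunOnFinite.symm fun d => if l ∣ d.1 then lam.parts.count (d.1 / l) else 0

/-- The numbers of `d`-cycles, `1 ≤ d ≤ b`. -/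
noncomputable def cycleCountVec {α : Type*} [Fintype α] [DecidableEq α] (b : ℕ)
    (σ : Equiv.Perm α) : Finset.Icc 1 b →₀ ℕ :=
  Finsupp.equivFunOnFinite.symm fun d => cycleCount σ d.1

open scoped Classical in
/-- The generating function of the cycles contributed by a block cycle of length `l`. -/
noncomputable def blockWeight (b l : ℕ) : MvPolynomial (Finset.Icc 1 b) ℝ :=
  (Fintype.card Γ : ℝ)⁻¹ •
    ∑ ρ : Γ, MvPolynomial.monomial (typeCycleVec b l (permPartition ρ.1)) 1

/-- The element of the wreath product with block permutation `h` and entries `γ i ∈ Γ`. -/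
def wreathPerm {n : ℕ} (h : Equiv.Perm (Fin n)) (γ : Fin n → Γ) : Equiv.Perm (Fin n × Fin k) :=
  Equiv.prodShear h fun i => (γ i).1

theorem cycleCountVec_wreathPerm {n : ℕ} (b : ℕ) (h : Equiv.Perm (Fin n)) (γ : Fin n → Γ)
    [Fintype (CycleClass h)] :
    cycleCountVec b (wreathPerm Γ h γ) = ∑ q : CycleClass h,
      typeCycleVec b (minimalPeriod h q.out) (permPartition (cycleProduct h γ q.out).1) := by
  ext d
  rw [Finsupp.finsetSum_apply]
  have h0 : cycleCountVec b (wreathPerm Γ h γ) d = cycleCount (wreathPerm Γ h γ) d.1 := rfl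
  rw [h0, wreathPerm, cycleCount_prodShear _ _ (Finset.mem_Icc.1 d.2).1]
  refine Finset.sum_congr (by ext; simp) fun q _ => ?_
  have : (cycleProduct h γ q.out).1 = cycleProduct h (fun i => (γ i).1) q.out :=
    map_cocycle Γ.subtype h γ _ _
  rw [this]
  rfl

open scoped Classical in
theorem sum_monomial_cycleCountVec_eq_prod {n : ℕ} (b : ℕ) (h : Equiv.Perm (Fin n)) :
    ∑ γ : Fin n → Γ, MvPolynomial.monomial (cycleCountVec b (wreathPerm Γ h γ)) (1 : ℝ) =
      (Fintype.card (Fin n → Γ) : ℝ) • (h.partition.parts.map (blockWeight Γ b)).prod := by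
  have hΓ : (Fintype.card Γ : ℝ) ≠ 0 := Nat.cast_ne_zero.2 Fintype.card_ne_zero
  have hQ : (Fintype.card (CycleClass h → Γ) : ℝ) ≠ 0 := Nat.cast_ne_zero.2 Fintype.card_ne_zero
  have h1 := sum_cycleProduct (G := Γ) h fun ρ => ∏ q : CycleClass h, MvPolynomial.monomial
    (typeCycleVec b (minimalPeriod h q.out) (permPartition (ρ q).1)) (1 : ℝ)
  simp only [← MvPolynomial.monomial_sum_one, ← cycleCountVec_wreathPerm] at h1
  have h2 : ∑ ρ : CycleClass h → Γ, MvPolynomial.monomial (∑ q : CycleClass h,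
      typeCycleVec b (minimalPeriod h q.out) (permPartition (ρ q).1)) (1 : ℝ) =
      (Fintype.card (CycleClass h → Γ) : ℝ) • (h.partition.parts.map (blockWeight Γ b)).prod := by
    simp only [MvPolynomial.monomial_sum_one]
    rw [← Fintype.prod_sum (fun (q : CycleClass h) (ρ : Γ) => MvPolynomial.monomial
      (typeCycleVec b (minimalPeriod h q.out) (permPartition ρ.1)) (1 : ℝ)),
      parts_partition_eq_map_minimalPeriod, Multiset.map_map, Fintype.card_fun, Nat.cast_pow,
      ← Finset.card_univ (α := CycleClass h), ← Finset.prod_const, Finset.prod_map_val,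
      ← Finset.prod_smul]
    refine Finset.prod_congr rfl fun q _ => ?_
    rw [Function.comp_apply, blockWeight, smul_smul, mul_inv_cancel₀ hΓ, one_smul]
  rw [h2, ← Nat.cast_smul_eq_nsmul ℝ, ← Nat.cast_smul_eq_nsmul ℝ, smul_comm] at h1
  exact (smul_right_injective _ hQ) h1

open scoped Classical in
theorem sum_monomial_cycleCountVec (n b : ℕ) :
    ∑ p : Equiv.Perm (Fin n) × (Fin n → Γ),
      MvPolynomial.monomial (cycleCountVec b (wreathPerm Γ p.1 p.2)) (1 : ℝ) =
      (Fintype.card (Equiv.Perm (Fin n) × (Fin n → Γ)) : ℝ) • cycleIndex (blockWeight Γ b) n := by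
  rw [Fintype.sum_prod_type]
  simp only [sum_monomial_cycleCountVec_eq_prod]
  rw [← Finset.smul_sum, sum_prod_partition_eq, smul_smul, Fintype.card_prod, Fintype.card_perm,
    Fintype.card_fin, mul_comm]
  push_cast
  rfl

/-- The colour of a block cycle: its length `l ≤ b` and the cycle type of its cycle product. -/
abbrev BlockColour (k b : ℕ) : Type := Finset.Icc 1 b × k.Partition

theorem sum_cycleTypeProb_smul {M : Type*} [AddCommGroup M] [Module ℝ M] (f : k.Partition → M)
    [Fintype Γ] :
    ∑ lam : k.Partition, (cycleTypeProb Γ lam : ℝ) • f lam =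
      (Fintype.card Γ : ℝ)⁻¹ • ∑ ρ : Γ, f (permPartition ρ.1) := by
  classical
  rw [← Finset.sum_fiberwise (g := fun ρ : Γ => permPartition ρ.1), Finset.smul_sum]
  refine Finset.sum_congr rfl fun lam _ => ?_
  rw [Finset.sum_congr rfl (g := fun _ => f lam) fun ρ hρ => by rw [(Finset.mem_filter.1 hρ).2],
    Finset.sum_const, ← Nat.cast_smul_eq_nsmul ℝ, smul_smul, cycleTypeProb,
    Nat.card_eq_fintype_card, Nat.card_eq_fintype_card, Fintype.card_subtype]
  push_cast
  rw [div_eq_inv_mul]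
  congr 4
  ext ρ
  simp [permPartition, Nat.Partition.ext_iff]

theorem sum_blockColour {M : Type*} [AddCommMonoid M] {b l : ℕ} (hl : l ∈ Finset.Icc 1 b)
    (f : BlockColour k b → M) :
    ∑ i with i.1.1 = l, f i = ∑ lam : k.Partition, f (⟨l, hl⟩, lam) := by
  rw [Finset.sum_filter, Fintype.sum_prod_type, Finset.sum_eq_single ⟨l, hl⟩]
  · simp
  · rintro ⟨m, hm⟩ _ hne
    have : m ≠ l := fun h => hne (by simp [h])
    simp [this]
  · simp

theorem sum_cycleTypeProb_blockColour {b l : ℕ} (hl : l ∈ Finset.Icc 1 b) :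
    ∑ i : BlockColour k b with i.1.1 = l, (cycleTypeProb Γ i.2 : ℝ) = 1 := by
  classical
  rw [sum_blockColour hl]
  have := sum_cycleTypeProb_smul Γ fun _ => (1 : ℝ)
  have hΓ : (Fintype.card Γ : ℝ) ≠ 0 := Nat.cast_ne_zero.2 Fintype.card_ne_zero
  simpa [hΓ] using this

theorem aeval_colourWeight (b l : ℕ) :
    MvPolynomial.aeval
      (fun i : BlockColour k b => MvPolynomial.monomial (typeCycleVec b i.1.1 i.2) (1 : ℝ))
      (colourWeight (fun i : BlockColour k b => i.1.1) (fun i => (cycleTypeProb Γ i.2 : ℝ)) b l) =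
    blockWeight Γ b l := by
  classical
  rw [colourWeight]
  split_ifs with hl
  · rw [sum_blockColour hl, map_sum]
    simp only [MvPolynomial.aeval_monomial, Finsupp.prod_single_index, pow_zero, pow_one,
      ← Algebra.smul_def]
    rw [sum_cycleTypeProb_smul, blockWeight]
  · have : ∀ lam : k.Partition, typeCycleVec b l lam = 0 := by
      intro lam
      ext d
      have hd := Finset.mem_Icc.1 d.2
      change (if l ∣ d.1 then lam.parts.count (d.1 / l) else 0) = 0
      rw [if_neg]
      intro hdvd
      have h1 := Nat.le_of_dvd (by omega) hdvd
      have h2 := Nat.pos_of_dvd_of_pos hdvd (by omega)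
      exact hl (Finset.mem_Icc.2 ⟨h2, by omega⟩)
    have hΓ : (Fintype.card Γ : ℝ) ≠ 0 := Nat.cast_ne_zero.2 Fintype.card_ne_zero
    simp only [blockWeight, this]
    rw [Finset.sum_const, Finset.card_univ, ← Nat.cast_smul_eq_nsmul ℝ, smul_smul,
      inv_mul_cancel₀ hΓ, one_smul, map_one]
    rfl

/-- The probability generating function of the numbers of block cycles of each colour, for a
uniform element of the wreath product. -/
noncomputable def blockPGF (b n : ℕ) : MvPolynomial (BlockColour k b) ℝ :=
  cycleIndex (colourWeight (fun i : BlockColour k b => i.1.1)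
    (fun i => (cycleTypeProb Γ i.2 : ℝ)) b) n

/-- The cycle counts obtained from the numbers `a i` of block cycles of colour `i`. -/
noncomputable def assembleCounts {b : ℕ} (a : BlockColour k b → ℕ) (d : Finset.Icc 1 b) : ℕ :=
  ∑ i, a i * typeCycleVec b i.1.1 i.2 d

open scoped Classical in
/-- The cycle counts of a uniform element of the wreath product, in terms of the law of the
coloured block cycles. -/
theorem card_filter_cycleCountVec (n b : ℕ) (A : Set (Finset.Icc 1 b → ℕ)) :
    (Finset.card {p : Equiv.Perm (Fin n) × (Fin n → Γ) |
        (fun i : Finset.Icc 1 b => cycleCount (wreathPerm Γ p.1 p.2) i.1) ∈ A} : ℝ) =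
      Fintype.card (Equiv.Perm (Fin n) × (Fin n → Γ)) *
        ∑ a ∈ (blockPGF Γ b n).support.filter
          fun a : BlockColour k b →₀ ℕ => assembleCounts a ∈ A, (blockPGF Γ b n).coeff a := by
  set U := blockPGF Γ b n with hU
  -- the probability of `A`, as a linear functional of the generating function
  set Φ : MvPolynomial (Finset.Icc 1 b) ℝ →ₗ[ℝ] ℝ :=
    (MvPolynomial.basisMonomials (Finset.Icc 1 b) ℝ).constr ℝ
      fun v => if (v : Finset.Icc 1 b → ℕ) ∈ A then (1 : ℝ) else 0 with hΦ
  have hΦm : ∀ v, Φ (MvPolynomial.monomial v 1) =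
      if (v : Finset.Icc 1 b → ℕ) ∈ A then (1 : ℝ) else 0 := by
    intro v
    rw [hΦ, ← Module.Basis.constr_basis (MvPolynomial.basisMonomials (Finset.Icc 1 b) ℝ) ℝ
      (fun v => if (v : Finset.Icc 1 b → ℕ) ∈ A then (1 : ℝ) else 0) v,
      MvPolynomial.coe_basisMonomials]
  have h1 := congrArg Φ (sum_monomial_cycleCountVec Γ n b)
  have h2 := map_cycleIndex (MvPolynomial.aeval
      (fun i : BlockColour k b => MvPolynomial.monomial (typeCycleVec b i.1.1 i.2) (1 : ℝ)))
      (colourWeight (fun i : BlockColour k b => i.1.1) (fun i => (cycleTypeProb Γ i.2 : ℝ)) b) n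
  rw [← blockPGF, ← hU] at h2
  simp only [aeval_colourWeight] at h2
  have h3 : ∀ a : BlockColour k b →₀ ℕ, MvPolynomial.aeval
      (fun i : BlockColour k b => MvPolynomial.monomial (typeCycleVec b i.1.1 i.2) (1 : ℝ))
      (MvPolynomial.monomial a (U.coeff a)) = U.coeff a •
        MvPolynomial.monomial (∑ i, a i • typeCycleVec b i.1.1 i.2) (1 : ℝ) := by
    intro a
    rw [MvPolynomial.aeval_monomial, ← Algebra.smul_def, MvPolynomial.monomial_sum_one,
      Finsupp.prod_fintype _ _ (by simp)]
    simp [MvPolynomial.monomial_pow]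
  have h4 : ∀ a : BlockColour k b →₀ ℕ,
      (((∑ i, a i • typeCycleVec b i.1.1 i.2 : Finset.Icc 1 b →₀ ℕ)) : Finset.Icc 1 b → ℕ) =
        assembleCounts a := by
    intro a
    funext d
    rw [Finsupp.finsetSum_apply]
    rfl
  rw [map_sum, map_smul, ← h2, U.as_sum, map_sum, map_sum] at h1
  simp only [h3, map_smul, hΦm, h4, smul_eq_mul, mul_ite, mul_one, mul_zero,
    ← Finset.sum_filter] at h1
  rw [← h1]
  rw [Finset.sum_const, nsmul_eq_mul, mul_one]
  rfl

open scoped Classical in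
theorem wreathCycleLaw_real (n b : ℕ) (A : Set (Finset.Icc 1 b → ℕ)) :
    (wreathCycleLaw Γ n b).real A =
      ∑ a ∈ (blockPGF Γ b n).support.filter
          fun a : BlockColour k b →₀ ℕ => assembleCounts a ∈ A, (blockPGF Γ b n).coeff a := by
  let : Fintype (wreath Γ n) := Fintype.ofFinite _
  set S := Equiv.Perm (Fin n) × (Fin n → Γ)
  have hS : (Fintype.card S : ℝ) ≠ 0 := Nat.cast_ne_zero.2 Fintype.card_ne_zero
  have hW : (Fintype.card (wreath Γ n) : ℝ) ≠ 0 := Nat.cast_ne_zero.2 Fintype.card_ne_zero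
  let f : wreath Γ n → Finset.Icc 1 b → ℕ := fun σ i => cycleCount σ.1 i.1
  have h1 : (wreathCycleLaw Γ n b).real A =
      (Finset.card {σ : wreath Γ n | f σ ∈ A} : ℝ) / Fintype.card (wreath Γ n) := by
    have : wreathCycleLaw Γ n b = ((PMF.uniformOfFintype (wreath Γ n)).map f).toMeasure := rfl
    rw [measureReal_def, this, PMF.toMeasure_apply_eq_toOuterMeasure_apply _
      A.to_countable.measurableSet,
      PMF.toOuterMeasure_map_apply, PMF.toOuterMeasure_uniformOfFintype_apply,
      ENNReal.toReal_div, ENNReal.toReal_natCast, ENNReal.toReal_natCast, Fintype.card_subtype]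
    rfl
  let e : S → wreath Γ n := fun p =>
    ⟨wreathPerm Γ p.1 p.2, fun i => (p.2 i).1, p.1, fun i => (p.2 i).2, fun _ _ => rfl⟩
  have he : (Finset.card {σ : wreath Γ n | f σ ∈ A} : ℝ) * Fintype.card S =
      Finset.card {p : S | f (e p) ∈ A} * Fintype.card (wreath Γ n) := by
    rcases Nat.eq_zero_or_pos k with rfl | hk
    · -- for `k = 0` the parametrization is not injective, but the only permutation is `1`
      have hc : ∀ σ, f σ = f 1 := fun σ => congrArg f (Subsingleton.elim _ _)
      simp only [hc]
      by_cases h : f 1 ∈ A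
      · simp [h, mul_comm, Finset.card_univ]
      · simp [h]
    · have hbij : Function.Bijective e := by
        constructor
        · rintro ⟨h, γ⟩ ⟨h', γ'⟩ heq
          have h0 : ∀ i x, ((h i, (γ i).1 x) : Fin n × Fin k) = (h' i, (γ' i).1 x) :=
            fun i x => congrArg (fun σ : wreath Γ n => σ.1 (i, x)) heq
          refine Prod.ext (Equiv.ext fun i => (Prod.mk.inj (h0 i ⟨0, hk⟩)).1) ?_
          exact funext fun i => Subtype.ext (Equiv.ext fun x => (Prod.mk.inj (h0 i x)).2)
        · rintro ⟨σ, γ, h, hγ, hσ⟩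
          refine ⟨(h, fun i => ⟨γ i, hγ i⟩), Subtype.ext (Equiv.ext ?_)⟩
          rintro ⟨i, x⟩
          exact (hσ i x).symm
      rw [Fintype.card_of_bijective hbij]
      congr 2
      exact (Finset.card_bijective e hbij (by simp)).symm
  have h2 := card_filter_cycleCountVec Γ n b A
  rw [h1, div_eq_iff hW]
  apply mul_right_cancel₀ hS
  rw [he]
  change (Finset.card {p : S | f (e p) ∈ A} : ℝ) = _ at h2
  rw [h2]
  ring

end WreathLaw

/-! ### Comparison with the compound Poisson law -/

section TotalVariation

theorem tvDist_le_of_forall_sub_le {α : Type*} [MeasurableSpace α] {μ ν : Measure α}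
    [IsProbabilityMeasure μ] [IsProbabilityMeasure ν] {c : ℝ}
    (h : ∀ A, MeasurableSet A → μ.real A - ν.real A ≤ c) : tvDist μ ν ≤ c := by
  have : Nonempty {A : Set α // MeasurableSet A} := ⟨⟨∅, MeasurableSet.empty⟩⟩
  refine ciSup_le fun A => abs_sub_le_iff.2 ⟨h A.1 A.2, ?_⟩
  have := h _ A.2.compl
  rw [probReal_compl_eq_one_sub A.2, probReal_compl_eq_one_sub A.2] at this
  linarith

theorem hasSum_measureReal_singleton {α : Type*} [MeasurableSpace α] [Countable α]
    [MeasurableSingletonClass α] (μ : Measure α) [IsProbabilityMeasure μ] :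
    HasSum (fun a => μ.real {a}) 1 := by
  have h1 : ∑' a, μ {a} = 1 := by
    have := μ.tsum_indicator_apply_singleton Set.univ MeasurableSet.univ
    simpa using this
  have h2 := ENNReal.hasSum_toReal (f := fun a => μ {a}) (by rw [h1]; exact ENNReal.one_ne_top)
  rwa [← ENNReal.tsum_toReal_eq fun a => measure_ne_top μ _, h1] at h2

theorem hasSum_measureReal_singleton_finsupp {ι : Type*} [Fintype ι] (μ : Measure (ι → ℕ))
    [IsProbabilityMeasure μ] : HasSum (fun a : ι →₀ ℕ => μ.real {(a : ι → ℕ)}) 1 :=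
  (Equiv.hasSum_iff (f := fun a : ι → ℕ => μ.real {a}) Finsupp.equivFunOnFinite).2
    (hasSum_measureReal_singleton μ)

end TotalVariation

section PoissonSide

variable {k : ℕ} {Γ : Subgroup (Equiv.Perm (Fin k))} {Ω : Type*} [MeasurableSpace Ω]
  {P : Measure Ω} {Z : ℕ → k.Partition → Ω → ℕ}

theorem IsPoissonFamily.map_blockColour [IsProbabilityMeasure P] (hZ : IsPoissonFamily Γ P Z)
    (b : ℕ) :
    P.map (fun ω (i : BlockColour k b) => Z i.1.1 i.2 ω) =
      Measure.pi fun i : BlockColour k b =>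
        poissonMeasure (cycleTypeProb Γ i.2 / (i.1.1 : ℝ≥0)) := by
  let e : BlockColour k b → ℕ+ × k.Partition := fun i =>
    (⟨i.1.1, (Finset.mem_Icc.1 i.1.2).1⟩, i.2)
  have he : Function.Injective e := by
    rintro ⟨⟨l, hl⟩, lam⟩ ⟨⟨m, hm⟩, lam'⟩ h
    obtain ⟨h1, rfl⟩ := Prod.mk.inj h
    have h1 : l = m := congrArg PNat.val h1
    subst h1
    rfl
  have h1 := (iIndepFun_iff_map_fun_eq_pi_map fun i : BlockColour k b =>
    (hZ.measurable (e i).1 (e i).2).aemeasurable).1 (hZ.indep.precomp he)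
  refine h1.trans (congrArg Measure.pi (funext fun i => ?_))
  exact hZ.law (e i).1 (e i).2

theorem compoundPoisson_eq_assembleCounts {Ω : Type*} (Z : ℕ → k.Partition → Ω → ℕ) (b : ℕ)
    (ω : Ω) :
    (fun d : Finset.Icc 1 b => compoundPoisson Z d.1 ω) =
      assembleCounts fun i : BlockColour k b => Z i.1.1 i.2 ω := by
  funext ⟨d, hd⟩
  have hd1 := Finset.mem_Icc.1 hd
  have h1 : assembleCounts (fun i : BlockColour k b => Z i.1.1 i.2 ω) ⟨d, hd⟩ =
      ∑ l : Finset.Icc 1 b, ∑ lam : k.Partition,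
        Z l.1 lam ω * (if l.1 ∣ d then lam.parts.count (d / l.1) else 0) := by
    rw [assembleCounts, Fintype.sum_prod_type]
    rfl
  rw [h1, Finset.sum_coe_sort (Finset.Icc 1 b) fun l => ∑ lam : k.Partition,
        Z l lam ω * (if l ∣ d then lam.parts.count (d / l) else 0), compoundPoisson,
    Nat.sum_divisorsAntidiagonal' fun j l => ∑ lam : k.Partition, lam.parts.count j * Z l lam ω]
  have hsub : d.divisors ⊆ Finset.Icc 1 b := by
    intro l hl
    have h2 := Nat.divisor_le hl
    have h3 := Nat.pos_of_mem_divisors hl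
    exact Finset.mem_Icc.2 ⟨h3, by omega⟩
  rw [← Finset.sum_subset hsub]
  · refine Finset.sum_congr rfl fun l hl => Finset.sum_congr rfl fun lam _ => ?_
    rw [if_pos (Nat.dvd_of_mem_divisors hl), mul_comm]
  · intro l _ hl
    refine Finset.sum_eq_zero fun lam _ => ?_
    rw [if_neg fun h => hl (Nat.mem_divisors.2 ⟨h, by omega⟩), mul_zero]

/-- The law of the coloured block cycles is within `2 * b / (n + 1)` of independent Poisson
variables. -/
theorem sum_coeff_blockPGF_sub_le (Γ : Subgroup (Equiv.Perm (Fin k))) (b n : ℕ)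
    (s : Finset (BlockColour k b →₀ ℕ)) :
    ∑ a ∈ s, ((blockPGF Γ b n).coeff a - (Measure.pi fun i : BlockColour k b =>
        poissonMeasure (cycleTypeProb Γ i.2 / (i.1.1 : ℝ≥0))).real {(a : BlockColour k b → ℕ)}) ≤
      2 * b / ((n : ℝ) + 1) := by
  set Q := Measure.pi fun i : BlockColour k b =>
    poissonMeasure (cycleTypeProb Γ i.2 / (i.1.1 : ℝ≥0)) with hQ
  have hq : ∀ a : BlockColour k b → ℕ, Q.real {a} = ∏ i, (Real.exp
      (-(cycleTypeProb Γ i.2 / (i.1.1 : ℝ≥0) : ℝ≥0)) *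
        ((cycleTypeProb Γ i.2 / (i.1.1 : ℝ≥0) : ℝ≥0) : ℝ) ^ a i / (a i).factorial) := by
    intro a
    rw [measureReal_def, hQ, Measure.pi_singleton, ENNReal.toReal_prod]
    exact Finset.prod_congr rfl fun i _ => poissonMeasure_real_singleton _ _
  refine sum_coeff_cycleIndex_sub_le (len := fun i : BlockColour k b => i.1.1)
    (p := fun i => (cycleTypeProb Γ i.2 : ℝ)) (fun i => NNReal.coe_nonneg _) (fun i => i.1.2)
    (fun l hl => sum_cycleTypeProb_blockColour Γ hl)
    (q := fun a => Q.real {(a : BlockColour k b → ℕ)}) (fun _ => measureReal_nonneg) ?_ ?_ ?_ n s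
  · rw [hq]
    simp only [Finsupp.coe_zero, Pi.zero_apply, pow_zero, mul_one, Nat.factorial_zero,
      Nat.cast_one, div_one]
    exact (Finset.prod_pos fun _ _ => Real.exp_pos _).ne'
  · exact hasSum_measureReal_singleton_finsupp Q
  · intro i a
    classical
    rw [hq, hq, ← Finset.mul_prod_erase _ _ (Finset.mem_univ i),
      ← Finset.mul_prod_erase (a := i) Finset.univ _ (Finset.mem_univ i)]
    have h1 : ∀ j ∈ Finset.univ.erase i,
        (a + Finsupp.single i 1 : BlockColour k b →₀ ℕ) j = a j := by
      intro j hj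
      simp [(Finset.ne_of_mem_erase hj).symm]
    have h2 : (a + Finsupp.single i 1 : BlockColour k b →₀ ℕ) i = a i + 1 := by simp
    rw [Finset.prod_congr rfl fun j hj => by rw [h1 j hj], h2, Nat.factorial_succ, pow_succ]
    have h3 : ((a i : ℝ) + 1) ≠ 0 := by positivity
    have h4 : ((a i).factorial : ℝ) ≠ 0 := by positivity
    push_cast
    field_simp

theorem tvDist_wreathCycleLaw_le [IsProbabilityMeasure P] (hZ : IsPoissonFamily Γ P Z)
    (n b : ℕ) :
    tvDist (wreathCycleLaw Γ n b)
      (P.map fun ω (i : Finset.Icc 1 b) => compoundPoisson Z i.1 ω) ≤ 2 * b / ((n : ℝ) + 1) := by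
  classical
  have hmeas : Measurable fun ω (i : BlockColour k b) => Z i.1.1 i.2 ω :=
    measurable_pi_lambda _ fun i =>
      hZ.measurable ⟨i.1.1, (Finset.mem_Icc.1 i.1.2).1⟩ i.2
  have hasm : Measurable (assembleCounts : (BlockColour k b → ℕ) → Finset.Icc 1 b → ℕ) :=
    measurable_of_countable _
  have hmap : (P.map fun ω (i : Finset.Icc 1 b) => compoundPoisson Z i.1 ω) =
      (Measure.pi fun i : BlockColour k b =>
        poissonMeasure (cycleTypeProb Γ i.2 / (i.1.1 : ℝ≥0))).map assembleCounts := by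
    rw [← hZ.map_blockColour, Measure.map_map hasm hmeas]
    exact congrArg P.map (funext fun ω => compoundPoisson_eq_assembleCounts Z b ω)
  rw [hmap]
  set Q := Measure.pi fun i : BlockColour k b =>
    poissonMeasure (cycleTypeProb Γ i.2 / (i.1.1 : ℝ≥0)) with hQ
  have : IsProbabilityMeasure (Q.map assembleCounts) :=
    Measure.isProbabilityMeasure_map hasm.aemeasurable
  have : IsProbabilityMeasure (wreathCycleLaw Γ n b) := by
    unfold wreathCycleLaw
    infer_instance
  refine tvDist_le_of_forall_sub_le fun A hA => ?_
  rw [wreathCycleLaw_real, map_measureReal_apply hasm hA]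
  set s := (blockPGF Γ b n).support.filter
    fun a : BlockColour k b →₀ ℕ => assembleCounts a ∈ A
  have h1 := sum_coeff_blockPGF_sub_le Γ b n s
  rw [Finset.sum_sub_distrib] at h1
  have h2 : ∑ a ∈ s, Q.real {(a : BlockColour k b → ℕ)} ≤ Q.real (assembleCounts ⁻¹' A) := by
    rw [← Finset.sum_image (f := fun a : BlockColour k b → ℕ => Q.real {a})
      (g := fun a : BlockColour k b →₀ ℕ => (a : BlockColour k b → ℕ))
      DFunLike.coe_injective.injOn, sum_measureReal_singleton]
    refine measureReal_mono ?_
    intro a ha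
    obtain ⟨c, hc, rfl⟩ := Finset.mem_image.1 (Finset.mem_coe.1 ha)
    exact (Finset.mem_filter.1 hc).2
  linarith

end PoissonSide

/-! ### Spacings in Bernoulli sequences -/

section Spacings

/-- The only ways in which the spacings of length at most `b` of `x_1, …, x_n, 1, 0, 0, …` and of
`x_1, x_2, …` can differ: the terminal `1` ends a spacing that `x` does not have there, or `x` has
a spacing that ends after position `n + 1`. The length is `l + 1` in both cases; in the second one
the truncated subtraction makes `n - l + t + 1`, `t ≥ 0`, run over all the starting positions `≥ 1`
of spacings that end after `n + 1`. -/
def SpacingsDiffer (x : ℕ → Bool) (n b : ℕ) : Prop :=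
  (∃ l ∈ Finset.range b, l < n ∧ x (n - l) = true ∧
      (∀ m ∈ Finset.Ioo (n - l) (n + 1), x m = false) ∧ x (n + 1) = false) ∨
    ∃ l ∈ Finset.range b, ∃ t, IsSpacing x (l + 1) (n - l + t + 1)

theorem isSpacing_truncSeq_iff {x : ℕ → Bool} {n b : ℕ} (hx : ¬SpacingsDiffer x n b) {l i : ℕ}
    (hl : l ∈ Finset.Icc 1 b) (hi : 1 ≤ i) :
    i ≤ n ∧ IsSpacing (truncSeq n x) l i ↔ IsSpacing x l i := by
  rw [SpacingsDiffer, not_or] at hx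
  obtain ⟨h1, h2⟩ := hx
  push Not at h1 h2
  have hl' := Finset.mem_Icc.1 hl
  have hlow : ∀ m, m ≤ n → truncSeq n x m = x m := fun m hm => if_pos hm
  have hhigh : ∀ m, n < m → truncSeq n x m = decide (m = n + 1) := fun m hm =>
    if_neg (by omega)
  rcases Nat.lt_trichotomy (i + l) (n + 1) with h | h | h
  · rw [and_iff_right (by omega), IsSpacing, IsSpacing, hlow i (by omega), hlow (i + l) (by omega)]
    refine and_congr_right fun _ => and_congr_left fun _ => forall₂_congr fun m hm => ?_
    rw [hlow m (by have := Finset.mem_Ioo.1 hm; omega)]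
  · rw [and_iff_right (by omega), IsSpacing, IsSpacing, hlow i (by omega), h,
      hhigh (n + 1) (by omega)]
    refine and_congr_right fun hi1 => ?_
    have hcongr : (∀ m ∈ Finset.Ioo i (n + 1), truncSeq n x m = false) ↔
        ∀ m ∈ Finset.Ioo i (n + 1), x m = false := forall₂_congr fun m hm => by
      rw [hlow m (by have := Finset.mem_Ioo.1 hm; omega)]
    rw [hcongr]
    refine and_congr_right fun hz => ?_
    have h3 := h1 (l - 1) (by simp; omega) (by omega)
    rw [show n - (l - 1) = i by omega] at h3
    simpa using h3 hi1 hz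
  · have h3 := h2 (l - 1) (by simp; omega) (i - 1 - (n - (l - 1)))
    rw [show l - 1 + 1 = l by omega,
      show n - (l - 1) + (i - 1 - (n - (l - 1))) + 1 = i by omega] at h3
    refine ⟨fun h4 => ?_, fun h4 => absurd h4 (by tauto)⟩
    have h5 := h4.2.2.2
    rw [hhigh _ (by omega)] at h5
    simp at h5
    omega

theorem spacingCount_mono {k : ℕ} (x : ℕ → Bool) (y : ℕ → k.Partition) (c : ℕ) :
    Monotone fun N => spacingCount x y N c := fun _ _ h =>
  Finset.sum_le_sum fun _ _ => Finset.sum_le_sum_of_subset (Finset.Icc_subset_Icc_right h)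

theorem finiteCount_eq_infiniteCount {k : ℕ} {x : ℕ → Bool} {n b : ℕ}
    (hx : ¬SpacingsDiffer x n b) (y : ℕ → k.Partition) {c : ℕ} (hc : c ∈ Finset.Icc 1 b) :
    ((finiteCount n x y c : ℕ) : ℕ∞) = infiniteCount x y c := by
  have hc' := Finset.mem_Icc.1 hc
  have hN : ∀ N, n ≤ N → spacingCount x y N c = finiteCount n x y c := by
    intro N hN
    refine Finset.sum_congr rfl fun p hp => ?_
    have hp1 := Nat.mem_divisorsAntidiagonal.1 hp
    have hp2 : p.2 ∈ Finset.Icc 1 b := by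
      have h1 : p.2 ∣ c := ⟨p.1, by rw [← hp1.1, mul_comm]⟩
      exact Finset.mem_Icc.2 ⟨Nat.pos_of_dvd_of_pos h1 hc'.1, (Nat.le_of_dvd hc'.1 h1).trans hc'.2⟩
    rw [← Finset.sum_subset (Finset.Icc_subset_Icc_right hN)]
    · refine Finset.sum_congr rfl fun i hi => ?_
      have hi' := Finset.mem_Icc.1 hi
      have h := isSpacing_truncSeq_iff hx hp2 hi'.1
      rw [and_iff_right hi'.2] at h
      simp only [h]
    · intro i hi hi'
      rw [if_neg]
      intro h
      have h1 := (isSpacing_truncSeq_iff hx hp2 (Finset.mem_Icc.1 hi).1).2 h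
      exact hi' (Finset.mem_Icc.2 ⟨(Finset.mem_Icc.1 hi).1, h1.1⟩)
  rw [infiniteCount]
  refine le_antisymm ?_ (iSup_le fun N => ?_)
  · rw [← hN n le_rfl]
    exact le_iSup (fun N => (spacingCount x y N c : ℕ∞)) n
  · rw [← hN (max n N) (le_max_left _ _)]
    exact Nat.cast_le.2 (spacingCount_mono x y c (le_max_right n N))

end Spacings

section SpacingData

variable {k : ℕ} {Γ : Subgroup (Equiv.Perm (Fin k))} {Ω : Type*} [MeasurableSpace Ω]
  {P : Measure Ω} {ζ : ℕ → Ω → Bool} {Y : ℕ → Ω → k.Partition}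

theorem measurableSet_isSpacing {x : ℕ → Ω → Bool} (hx : ∀ m, 1 ≤ m → Measurable (x m))
    (l : ℕ) {i : ℕ} (hi : 1 ≤ i) : MeasurableSet {ω | IsSpacing (fun m => x m ω) l i} := by
  have h : ∀ m, 1 ≤ m → ∀ c, MeasurableSet {ω | x m ω = c} := fun m hm c =>
    hx m hm (measurableSet_singleton c)
  refine (h i hi _).inter (MeasurableSet.inter ?_ (h _ (by omega) _))
  have : {ω | ∀ m ∈ Finset.Ioo i (i + l), x m ω = false} =
      ⋂ m ∈ Finset.Ioo i (i + l), {ω | x m ω = false} := by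
    ext ω; simp
  change MeasurableSet {ω | ∀ m ∈ Finset.Ioo i (i + l), x m ω = false}
  rw [this]
  exact Finset.measurableSet_biInter _ fun m hm =>
    h m (by have := Finset.mem_Ioo.1 hm; omega) _

theorem measurable_spacingCount {x : ℕ → Ω → Bool} (hx : ∀ m, 1 ≤ m → Measurable (x m))
    (hY : ∀ i, 1 ≤ i → Measurable (Y i)) (N c : ℕ) :
    Measurable fun ω => spacingCount (fun m => x m ω) (fun m => Y m ω) N c := by
  unfold spacingCount
  refine Finset.measurable_sum _ fun p _ => Finset.measurable_sum _ fun i hi => ?_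
  have hi' := (Finset.mem_Icc.1 hi).1
  refine Measurable.ite (measurableSet_isSpacing hx _ hi') ?_ measurable_const
  exact (measurable_from_top (f := fun lam : k.Partition => lam.parts.count p.1)).comp (hY i hi')

theorem measurable_truncSeq {x : ℕ → Ω → Bool} (hx : ∀ m, 1 ≤ m → Measurable (x m)) (n : ℕ) :
    ∀ m, 1 ≤ m → Measurable fun ω => truncSeq n (fun m => x m ω) m := by
  intro m hm
  by_cases h : m ≤ n
  · simpa only [truncSeq, if_pos h] using hx m hm
  · simp only [truncSeq, if_neg h]
    exact measurable_const

theorem measurable_iSup_natCast {f : ℕ → Ω → ℕ} (hf : ∀ N, Measurable (f N)) :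
    Measurable fun ω => ⨆ N, (f N ω : ℕ∞) := by
  have h : ∀ c : ℕ∞, MeasurableSet {ω | ⨆ N, (f N ω : ℕ∞) ≤ c} := by
    intro c
    simp only [iSup_le_iff, Set.ofPred_forall]
    exact MeasurableSet.iInter fun N =>
      hf N (Set.to_countable {m : ℕ | (m : ℕ∞) ≤ c}).measurableSet
  refine measurable_to_countable' fun c => ?_
  have : (fun ω => ⨆ N, (f N ω : ℕ∞)) ⁻¹' {c} =
      {ω | ⨆ N, (f N ω : ℕ∞) ≤ c} \ ⋃ c' : Set.Iio c, {ω | ⨆ N, (f N ω : ℕ∞) ≤ c'} := by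
    ext ω
    simp only [Set.mem_preimage, Set.mem_singleton_iff, Set.mem_sdiff, Set.mem_ofPred_eq,
      Set.mem_iUnion, not_exists, Subtype.forall, Set.mem_Iio]
    constructor
    · rintro rfl
      exact ⟨le_rfl, fun c' hc' h => absurd hc' (not_lt.2 h)⟩
    · rintro ⟨h1, h2⟩
      exact h1.eq_of_not_lt fun h3 => h2 _ h3 le_rfl
  rw [this]
  exact (h c).diff (MeasurableSet.iUnion fun c' => h c')

theorem IsSpacingData.measurable_zeta' (hD : IsSpacingData Γ P ζ Y) (m : ℕ) (hm : 1 ≤ m) :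
    Measurable (ζ m) := hD.measurable_zeta ⟨m, hm⟩

theorem IsSpacingData.measurable_Y' (hD : IsSpacingData Γ P ζ Y) (m : ℕ) (hm : 1 ≤ m) :
    Measurable (Y m) := hD.measurable_Y ⟨m, hm⟩

theorem IsSpacingData.measurable_finiteCount (hD : IsSpacingData Γ P ζ Y) (n b : ℕ) :
    Measurable fun ω (i : Finset.Icc 1 b) =>
      ((finiteCount n (fun m => ζ m ω) (fun m => Y m ω) i.1 : ℕ) : ℕ∞) :=
  measurable_pi_lambda _ fun i => (measurable_of_countable _).comp
    (measurable_spacingCount (measurable_truncSeq hD.measurable_zeta' n) hD.measurable_Y' n i.1)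

theorem IsSpacingData.measurable_infiniteCount (hD : IsSpacingData Γ P ζ Y) (b : ℕ) :
    Measurable fun ω (i : Finset.Icc 1 b) =>
      infiniteCount (fun m => ζ m ω) (fun m => Y m ω) i.1 :=
  measurable_pi_lambda _ fun i => measurable_iSup_natCast fun N =>
    measurable_spacingCount hD.measurable_zeta' hD.measurable_Y' N i.1

theorem IsSpacingData.prob_zeta_true (hD : IsSpacingData Γ P ζ Y) (m : ℕ) :
    P.real {ω | ζ (m + 1) ω = true} = 1 / ((m : ℝ) + 1) := by
  simpa using hD.law_zeta ⟨m + 1, m.succ_pos⟩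

theorem IsSpacingData.prob_zeta_false [IsProbabilityMeasure P] (hD : IsSpacingData Γ P ζ Y)
    (m : ℕ) : P.real {ω | ζ (m + 1) ω = false} = m / ((m : ℝ) + 1) := by
  have h1 : {ω | ζ (m + 1) ω = false} = {ω | ζ (m + 1) ω = true}ᶜ := by
    ext ω; simp
  have h2 : MeasurableSet {ω | ζ (m + 1) ω = true} :=
    hD.measurable_zeta' (m + 1) (by omega) (measurableSet_singleton true)
  have h3 : (m : ℝ) + 1 ≠ 0 := by positivity
  rw [h1, probReal_compl_eq_one_sub h2, hD.prob_zeta_true]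
  field_simp
  ring

theorem prod_range_telescope (a r : ℕ) :
    ∏ t ∈ Finset.range r, ((a : ℝ) + t + 1) / (a + (t + 1 : ℕ) + 1) =
      ((a : ℝ) + 1) / (a + r + 1) := by
  induction r with
  | zero =>
    have : (a : ℝ) + 1 ≠ 0 := by positivity
    simp [div_self this]
  | succ r ih =>
    have : (a : ℝ) + r + 1 ≠ 0 := by positivity
    rw [Finset.prod_range_succ, ih]
    field_simp

/-- The probability of a `1` at position `a + 1`, followed by `r` zeros and the value `c`; the
product over the zeros telescopes. -/
theorem IsSpacingData.prob_run [IsProbabilityMeasure P] (hD : IsSpacingData Γ P ζ Y) (a r : ℕ)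
    (c : Bool) :
    P.real {ω | ζ (a + 1) ω = true ∧
      (∀ m ∈ Finset.Ioo (a + 1) (a + 1 + (r + 1)), ζ m ω = false) ∧
        ζ (a + 1 + (r + 1)) ω = c} =
      1 / ((a : ℝ) + r + 1) * P.real {ω | ζ (a + r + 1 + 1) ω = c} := by
  have hind : iIndepFun (fun t : ℕ => ζ (a + t + 1)) P :=
    hD.indep_zeta.precomp (g := fun t : ℕ => (⟨a + t + 1, by omega⟩ : ℕ+)) fun s t h => by
      have := congrArg PNat.val h
      simp only [PNat.mk_coe] at this
      omega
  let ε : ℕ → Bool := fun t => if t = 0 then true else if t ≤ r then false else c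
  have hset : {ω | ζ (a + 1) ω = true ∧
      (∀ m ∈ Finset.Ioo (a + 1) (a + 1 + (r + 1)), ζ m ω = false) ∧
        ζ (a + 1 + (r + 1)) ω = c} =
      ⋂ t ∈ Finset.range (r + 2), ζ (a + t + 1) ⁻¹' {ε t} := by
    ext ω
    simp only [Set.mem_ofPred_eq, Set.mem_iInter, Set.mem_preimage, Set.mem_singleton_iff]
    constructor
    · rintro ⟨h1, h2, h3⟩ t ht
      have ht := Finset.mem_range.1 ht
      by_cases h0 : t = 0
      · subst h0
        simpa [ε] using h1
      · by_cases hr : t ≤ r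
        · simpa [ε, h0, hr] using h2 (a + t + 1) (Finset.mem_Ioo.2 (by omega))
        · obtain rfl : t = r + 1 := by omega
          simpa [ε, add_assoc, add_comm, add_left_comm] using h3
    · intro h
      refine ⟨by simpa [ε] using h 0 (by simp), fun m hm => ?_, ?_⟩
      · have hm := Finset.mem_Ioo.1 hm
        have := h (m - a - 1) (Finset.mem_range.2 (by omega))
        rw [show a + (m - a - 1) + 1 = m by omega] at this
        rw [this]
        simp only [ε]
        rw [if_neg (by omega), if_pos (by omega)]
      · have := h (r + 1) (by simp)
        rw [show a + (r + 1) + 1 = a + 1 + (r + 1) by omega] at this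
        rw [this]
        simp [ε]
  have htel : ∏ t ∈ Finset.range r, P.real (ζ (a + (t + 1) + 1) ⁻¹' {ε (t + 1)}) =
      ((a : ℝ) + 1) / (a + r + 1) := by
    have h1 : ∀ t ∈ Finset.range r, P.real (ζ (a + (t + 1) + 1) ⁻¹' {ε (t + 1)}) =
        ((a : ℝ) + t + 1) / (a + (t + 1 : ℕ) + 1) := by
      intro t ht
      have : ε (t + 1) = false := by
        have := Finset.mem_range.1 ht
        simp only [ε]
        rw [if_neg (by omega), if_pos (by omega)]
      rw [this]
      have h2 := hD.prob_zeta_false (a + (t + 1))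
      push_cast at h2 ⊢
      rw [← add_assoc, ← add_assoc] at h2
      rw [← add_assoc, ← add_assoc]
      exact h2
    rw [Finset.prod_congr rfl h1, prod_range_telescope]
  rw [hset, measureReal_def, hind.measure_inter_preimage_eq_mul _ fun t _ =>
    measurableSet_singleton _, ENNReal.toReal_prod, Finset.prod_range_succ, Finset.prod_range_succ']
  simp only [← measureReal_def]
  rw [htel]
  have h0 : P.real (ζ (a + 0 + 1) ⁻¹' {ε 0}) = 1 / ((a : ℝ) + 1) := hD.prob_zeta_true a
  have h1 : ε (r + 1) = c := by simp [ε]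
  have h2 : P.real (ζ (a + (r + 1) + 1) ⁻¹' {ε (r + 1)}) =
      P.real {ω | ζ (a + r + 1 + 1) ω = c} := by
    rw [h1]
    rfl
  rw [h0, h2]
  have h3 : (a : ℝ) + 1 ≠ 0 := by positivity
  have h4 : (a : ℝ) + r + 1 ≠ 0 := by positivity
  field_simp

theorem IsSpacingData.prob_isSpacing [IsProbabilityMeasure P] (hD : IsSpacingData Γ P ζ Y)
    (l s : ℕ) : P.real {ω | IsSpacing (fun m => ζ m ω) (l + 1) (s + 1)} =
      1 / ((s : ℝ) + l + 1) - 1 / ((s : ℝ) + l + 2) := by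
  have h := hD.prob_run s l true
  rw [hD.prob_zeta_true] at h
  refine h.trans ?_
  have h3 : (s : ℝ) + l + 1 ≠ 0 := by positivity
  have h4 : (s : ℝ) + l + 2 ≠ 0 := by positivity
  push_cast
  rw [show (s : ℝ) + l + 1 + 1 = s + l + 2 by ring]
  field_simp
  ring

theorem IsSpacingData.measure_spacingsDiffer_le [IsProbabilityMeasure P]
    (hD : IsSpacingData Γ P ζ Y) (n b : ℕ) :
    P.real {ω | SpacingsDiffer (fun m => ζ m ω) n b} ≤ 2 * b / ((n : ℝ) + 1) := by
  let B : ℕ → Set Ω := fun l => {ω | l < n ∧ ζ (n - l) ω = true ∧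
      (∀ m ∈ Finset.Ioo (n - l) (n + 1), ζ m ω = false) ∧ ζ (n + 1) ω = false}
  let E : ℕ → Set Ω := fun l => ⋃ t, {ω | IsSpacing (fun m => ζ m ω) (l + 1) (n - l + t + 1)}
  have hsub : {ω | SpacingsDiffer (fun m => ζ m ω) n b} ⊆
      (⋃ l ∈ Finset.range b, B l) ∪ ⋃ l ∈ Finset.range b, E l := by
    rintro ω (⟨l, hl, h⟩ | ⟨l, hl, t, h⟩)
    · exact Or.inl (Set.mem_biUnion (Finset.mem_coe.2 hl) h)
    · exact Or.inr (Set.mem_biUnion (Finset.mem_coe.2 hl) (Set.mem_iUnion.2 ⟨t, h⟩))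
  have hB : ∀ l, P.real (B l) ≤ 1 / ((n : ℝ) + 1) := by
    intro l
    by_cases hl : l < n
    · have h := hD.prob_run (n - l - 1) l false
      rw [hD.prob_zeta_false, show n - l - 1 + 1 = n - l by omega,
        show n - l + (l + 1) = n + 1 by omega] at h
      have hcast : ((n - l - 1 : ℕ) : ℝ) + l + 1 = n := by
        have : n - l - 1 + l + 1 = n := by omega
        exact_mod_cast congrArg (Nat.cast (R := ℝ)) this
      have hBl : B l = {ω | ζ (n - l) ω = true ∧
          (∀ m ∈ Finset.Ioo (n - l) (n + 1), ζ m ω = false) ∧ ζ (n + 1) ω = false} := by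
        ext ω
        exact and_iff_right hl
      rw [hBl, h]
      push_cast
      rw [hcast]
      have hn : (n : ℝ) ≠ 0 := Nat.cast_ne_zero.2 (by omega)
      apply le_of_eq
      field_simp
    · have : B l = ∅ := Set.eq_empty_of_forall_notMem fun ω hω => hl hω.1
      rw [this, measureReal_empty]
      positivity
  -- the sum over the starting positions telescopes
  have hE : ∀ l, P.real (E l) ≤ 1 / ((n : ℝ) + 1) := by
    intro l
    refine ENNReal.toReal_le_of_le_ofReal (by positivity) ?_
    refine (measure_iUnion_le _).trans (ENNReal.tsum_le_of_sum_range_le fun N => ?_)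
    simp only [← ofReal_measureReal (μ := P) (measure_ne_top P _), hD.prob_isSpacing]
    rw [← ENNReal.ofReal_sum_of_nonneg]
    · refine ENNReal.ofReal_le_ofReal ?_
      have h1 : ∀ t ∈ Finset.range N, 1 / (((n - l + t : ℕ) : ℝ) + l + 1) -
          1 / (((n - l + t : ℕ) : ℝ) + l + 2) =
          1 / (((n - l : ℕ) : ℝ) + l + 1 + t) - 1 / (((n - l : ℕ) : ℝ) + l + 1 + (t + 1 : ℕ)) := by
        intro t _
        push_cast
        congr 2 <;> ring
      rw [Finset.sum_congr rfl h1,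
        Finset.sum_range_sub' fun t : ℕ => 1 / (((n - l : ℕ) : ℝ) + l + 1 + t)]
      have h2 : (n : ℝ) ≤ ((n - l : ℕ) : ℝ) + l := by
        have : n ≤ n - l + l := by omega
        exact_mod_cast this
      have h3 : 1 / (((n - l : ℕ) : ℝ) + l + 1 + (0 : ℕ)) ≤ 1 / ((n : ℝ) + 1) := by
        apply one_div_le_one_div_of_le (by positivity)
        push_cast
        linarith
      have h4 : 0 ≤ 1 / (((n - l : ℕ) : ℝ) + l + 1 + N) := by positivity
      linarith
    · intro t _
      rw [← hD.prob_isSpacing]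
      exact measureReal_nonneg
  calc P.real {ω | SpacingsDiffer (fun m => ζ m ω) n b}
      ≤ P.real ((⋃ l ∈ Finset.range b, B l) ∪ ⋃ l ∈ Finset.range b, E l) := measureReal_mono hsub
    _ ≤ P.real (⋃ l ∈ Finset.range b, B l) + P.real (⋃ l ∈ Finset.range b, E l) :=
        measureReal_union_le _ _
    _ ≤ ∑ l ∈ Finset.range b, P.real (B l) + ∑ l ∈ Finset.range b, P.real (E l) :=
        add_le_add (measureReal_biUnion_finset_le _ _) (measureReal_biUnion_finset_le _ _)
    _ ≤ ∑ l ∈ Finset.range b, 1 / ((n : ℝ) + 1) + ∑ l ∈ Finset.range b, 1 / ((n : ℝ) + 1) :=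
        add_le_add (Finset.sum_le_sum fun l _ => hB l) (Finset.sum_le_sum fun l _ => hE l)
    _ = 2 * b / ((n : ℝ) + 1) := by
        rw [Finset.sum_const, Finset.card_range, nsmul_eq_mul]
        ring

theorem IsSpacingData.measure_finiteCount_ne_le [IsProbabilityMeasure P]
    (hD : IsSpacingData Γ P ζ Y) (n b : ℕ) :
    P.real {ω | ∃ i ∈ Finset.Icc 1 b,
      ((finiteCount n (fun m => ζ m ω) (fun m => Y m ω) i : ℕ) : ℕ∞) ≠
        infiniteCount (fun m => ζ m ω) (fun m => Y m ω) i} ≤ 2 * b / ((n : ℝ) + 1) := by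
  refine le_trans (measureReal_mono ?_) (hD.measure_spacingsDiffer_le n b)
  rintro ω ⟨i, hi, hne⟩
  by_contra h
  exact hne (finiteCount_eq_infiniteCount (x := fun m => ζ m ω) h _ hi)

end SpacingData

/-- The coupling inequality. -/
theorem tvDist_map_le {Ω α : Type*} [MeasurableSpace Ω] [MeasurableSpace α] {P : Measure Ω}
    [IsProbabilityMeasure P] {X X' : Ω → α} (hX : Measurable X) (hX' : Measurable X') :
    tvDist (P.map X) (P.map X') ≤ P.real {ω | X ω ≠ X' ω} := by
  have : IsProbabilityMeasure (P.map X) := Measure.isProbabilityMeasure_map hX.aemeasurable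
  have : IsProbabilityMeasure (P.map X') := Measure.isProbabilityMeasure_map hX'.aemeasurable
  refine tvDist_le_of_forall_sub_le fun A hA => ?_
  rw [map_measureReal_apply hX hA, map_measureReal_apply hX' hA, sub_le_iff_le_add]
  refine (measureReal_mono ?_).trans (measureReal_union_le _ _)
  intro ω hω
  by_cases h : X ω = X' ω
  · exact Or.inr (by rw [Set.mem_preimage, ← h]; exact hω)
  · exact Or.inl h

theorem theorem4p1 {k : ℕ} (Γ : Subgroup (Equiv.Perm (Fin k))) (n : ℕ) (hn : 1 ≤ n) (b : ℕ) :
    -- cycle counts of a uniform element of the wreath product versus the compound Poisson limit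
    (∀ {Ω : Type*} [MeasurableSpace Ω] (P : Measure Ω) [IsProbabilityMeasure P]
      (Z : ℕ → k.Partition → Ω → ℕ), IsPoissonFamily Γ P Z →
        tvDist (wreathCycleLaw Γ n b)
          (P.map fun ω (i : Finset.Icc 1 b) => compoundPoisson Z i.1 ω) ≤ 2 * (b : ℝ) / n) ∧
    -- the finite Bernoulli spacing construction versus the infinite one: distance of the laws,
    -- and the coupling of the two constructions on the same probability space
    (∀ {Ω : Type*} [MeasurableSpace Ω] (P : Measure Ω) [IsProbabilityMeasure P]
      (ζ : ℕ → Ω → Bool) (Y : ℕ → Ω → k.Partition), IsSpacingData Γ P ζ Y →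
        tvDist
          (P.map fun ω (i : Finset.Icc 1 b) =>
            ((finiteCount n (fun m => ζ m ω) (fun m => Y m ω) i.1 : ℕ) : ℕ∞))
          (P.map fun ω (i : Finset.Icc 1 b) =>
            infiniteCount (fun m => ζ m ω) (fun m => Y m ω) i.1) ≤ 2 * (b : ℝ) / n ∧
        P.real {ω | ∃ i ∈ Finset.Icc 1 b,
            ((finiteCount n (fun m => ζ m ω) (fun m => Y m ω) i : ℕ) : ℕ∞) ≠
              infiniteCount (fun m => ζ m ω) (fun m => Y m ω) i} ≤ 2 * (b : ℝ) / (n + 1)) := by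
  have hn' : (0 : ℝ) < n := Nat.cast_pos.2 hn
  have hle : 2 * (b : ℝ) / ((n : ℝ) + 1) ≤ 2 * (b : ℝ) / n := by
    gcongr
    linarith
  refine ⟨fun {Ω} _ P _ Z hZ => (tvDist_wreathCycleLaw_le hZ n b).trans hle,
    fun {Ω} _ P _ ζ Y hD => ⟨?_, hD.measure_finiteCount_ne_le n b⟩⟩
  refine (tvDist_map_le (hD.measurable_finiteCount n b) (hD.measurable_infiniteCount b)).trans
    (le_trans (measureReal_mono ?_) ((hD.measure_finiteCount_ne_le n b).trans hle))
  intro ω hω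
  obtain ⟨i, hi⟩ := Function.ne_iff.1 hω
  exact ⟨i.1, i.2, hi⟩
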